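/- **Theorem B.1 (asymptotic normality of multivariate local-polynomial estimators).** Let $d\ge 1$, $p\ge 0$ and let $(R_i,Y_i)_{i\ge1}$ be i.i.d. with $R_i\in\mathbb R^d$, $Y_i=m(R_i)+\varepsilon_i\in\mathbb R$, $E[\varepsilon_i\mid R_i]=0$. Fix $r\in\mathbb R^d$ and assume the following. 1. $R_i$ has a Lebesgue density $f$ that is continuous on a neighborhood of $r$, with $f(r)>0$. 2. $K:\mathbb R^d\to[0,\infty)$ is bounded, vanishes outside $[-C_K,C_K]^d$ for some $C_K>0$, $\int K(z)\,dz=1$, and the matrix $S$ defined below is nonsingular. (In the regression-discontinuity application $K$ is a one-sided kernel supported on $\{z_2\ge 0\}$ or on $\{z_2<0\}$; no such restriction is needed.) 3. $m$ is $(p+1)$ times continuously differentiable on a neighborhood of $r$; $\sigma^2(z)=E[\varepsilon_i^2\mid R_i=z]$ is continuous at $r$; and for some $\delta>0$, $E[|\varepsilon_i|^{2+\delta}\mid R_i=z]$ is bounded for $z$ in a neighborhood of $r$. 4. $h_j=h_{j,n}>0$ satisfy, as $n\to\infty$: $h_j\to0$ for all $j$; $n h_1\cdots h_d\,h_{j_1}^2\cdots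 h_{j_p}^2\to\infty$ for all $1\le j_1\le\dots\le j_p\le d$; and $n h_1\cdots h_d\,h_{j_1}^2\cdots h_{j_{p+1}}^2\to c_{j_1\dots j_{p+1}}\in[0,\infty)$ for all $1\le j_1\le\dots\le j_{p+1}\le d$. Index coordinates by the tuples $j=(j_1\le\dots\le j_L)$ in $\{1,\dots,d\}$, $0\le L\le p$ (the empty tuple for $L=0$); let $D$ be the number of such tuples and $\bar D$ the number of tuples $j_1\le\dots\le j_{p+1}$. Write $z_j=\prod_{\ell}z_{j_\ell}$ (equal to $1$ for the empty tuple), $s_j!=\prod_{k=1}^d(\#\{\ell:j_\ell=k\})!$, $\partial_j m=\partial_{j_1}\cdots\partial_{j_L}m$, and let $\phi(z)=(z_j)_{|j|\le p}\in\mathbb R^D$, $\psi(z)=(z_j)_{|j|=p+1}\in\mathbb R^{\bar D}$, where $|j|$ is the length of $j$. Put $$S=\int K(z)\phi(z)\phi(z)'\,dz,\quad \mathcal K=\int K(z)^2\phi(z)\phi(z)'\,dz,\quad B^{(d,p)}=\int K(z)\phi(z)\psi(z)'\,dz,$$ $$H=\mathrm{diag}(h_j)_{|j|\le p}\ \Big(h_j=\prod_\ell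 h_{j_\ell}\Big),\quad M(r)=\Big(\tfrac{\partial_j m(r)}{s_j!}\Big)_{|j|\le p},\quad M_n^{(d,p)}(r)=\Big(\tfrac{\partial_j m(r)}{s_j!}h_j\Big)_{|j|=p+1}.$$ Let $\hat\beta(r)=\hat\beta_n(r)$ be any (measurable) random vector that almost surely minimizes $$\sum_{i=1}^n\big(Y_i-\beta'\phi(R_i-r)\big)^2K\Big(\tfrac{R_{i,1}-r_1}{h_1},\dots,\tfrac{R_{i,d}-r_d}{h_d}\Big)\quad\text{over }\beta\in\mathbb R^D.$$ Then, as $n\to\infty$, $$\sqrt{nh_1\cdots h_d}\,\Big[H\big(\hat\beta(r)-M(r)\big)-S^{-1}B^{(d,p)}M_n^{(d,p)}(r)\Big]\ \xrightarrow{d}\ N\Big(0,\ \tfrac{\sigma^2(r)}{f(r)}S^{-1}\mathcal KS^{-1}\Big),$$ where the matrix $\tfrac{\sigma^2(r)}{f(r)}S^{-1}\mathcal KS^{-1}$ is positive semidefinite. -/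

import Mathlib

open MeasureTheory ProbabilityTheory Filter Topology

namespace LocalPoly

noncomputable section

/-- Weakly increasing index tuples `1 ≤ j_1 ≤ ⋯ ≤ j_L ≤ d`. -/
abbrev MonoTuple (d L : ℕ) : Type := {j : Fin L → Fin d // Monotone j}

/-- The index set of the coefficient vector: all weakly increasing tuples of length
`L` with `0 ≤ L ≤ p` (for `L = 0` this is the empty tuple, i.e. the intercept).
Its cardinality is the dimension `D`. -/
abbrev PolyIdx (d p : ℕ) : Type := Σ L : Fin (p + 1), MonoTuple d L

/-- `s_{j_1…j_L}! = ∏_k s_k!`, where `s_k = #{ℓ : j_ℓ = k}`. -/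
def multFactorial {d L : ℕ} (j : Fin L → Fin d) : ℕ :=
  ∏ k : Fin d, (Finset.univ.filter (fun ℓ => j ℓ = k)).card.factorial

/-- The monomial `∏_ℓ z_{j_ℓ}`. -/
def monom {d L : ℕ} (j : Fin L → Fin d) (z : Fin d → ℝ) : ℝ :=
  ∏ ℓ : Fin L, z (j ℓ)

/-- The partial derivative `∂_{j_1…j_L} m (r)`. -/
def partialD {d L : ℕ} (j : Fin L → Fin d) (m : (Fin d → ℝ) → ℝ) (r : Fin d → ℝ) : ℝ :=
  iteratedFDeriv ℝ L m r (fun ℓ => Pi.single (j ℓ) (1 : ℝ))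

/-- The rescaled deviation `((x_1 - r_1)/h_1, …, (x_d - r_d)/h_d)`, so that
`K_h (x - r) = K (rescale h r x)`. -/
def rescale {d : ℕ} (h r x : Fin d → ℝ) : Fin d → ℝ := fun k => (x k - r k) / h k

/-- `M(r)`: the partial derivatives of `m` at `r` up to order `p`, divided by `s!`. -/
def derivVec {d : ℕ} (p : ℕ) (m : (Fin d → ℝ) → ℝ) (r : Fin d → ℝ) : PolyIdx d p → ℝ :=
  fun a => partialD a.2.1 m r / (multFactorial a.2.1 : ℝ)

/-- `H = diag(1, h_1, …, h_d, h_1^2, h_1 h_2, …, h_d^p)`. -/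
def bandMatrix {d : ℕ} (p : ℕ) (h : Fin d → ℝ) : Matrix (PolyIdx d p) (PolyIdx d p) ℝ :=
  Matrix.diagonal (fun a => monom a.2.1 h)

/-- `S = ∫ K(z) (1, ž')' (1, ž') dz`. -/
def momentMatrix {d : ℕ} (p : ℕ) (K : (Fin d → ℝ) → ℝ) :
    Matrix (PolyIdx d p) (PolyIdx d p) ℝ :=
  Matrix.of fun a b => ∫ z, K z * monom a.2.1 z * monom b.2.1 z

/-- `𝒦 = ∫ K(z)^2 (1, ž')' (1, ž') dz`. -/
def sqMomentMatrix {d : ℕ} (p : ℕ) (K : (Fin d → ℝ) → ℝ) :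
    Matrix (PolyIdx d p) (PolyIdx d p) ℝ :=
  Matrix.of fun a b => ∫ z, K z ^ 2 * monom a.2.1 z * monom b.2.1 z

/-- `B^{(d,p)} = ∫ K(z) (1, ž')' (z)'_{p+1} dz`. -/
def biasMatrix {d : ℕ} (p : ℕ) (K : (Fin d → ℝ) → ℝ) :
    Matrix (PolyIdx d p) (MonoTuple d (p + 1)) ℝ :=
  Matrix.of fun a b => ∫ z, K z * monom a.2.1 z * monom b.1 z

/-- `M_n^{(d,p)}(r)`: the partial derivatives of order `p + 1` divided by `s!` and
multiplied by the bandwidth monomials. -/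
def biasVec {d : ℕ} (p : ℕ) (m : (Fin d → ℝ) → ℝ) (r h : Fin d → ℝ) :
    MonoTuple d (p + 1) → ℝ :=
  fun b => partialD b.1 m r / (multFactorial b.1 : ℝ) * monom b.1 h

/-- The kernel-weighted least-squares criterion of the first `n` observations `(x_i, y_i)`. -/
def criterion {d : ℕ} (p : ℕ) (K : (Fin d → ℝ) → ℝ) (h r : Fin d → ℝ) (n : ℕ)
    (x : ℕ → Fin d → ℝ) (y : ℕ → ℝ) (β : PolyIdx d p → ℝ) : ℝ :=
  ∑ i ∈ Finset.range n,
    (y i - ∑ a, β a * monom a.2.1 (x i - r)) ^ 2 * K (rescale h r (x i))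

/-- The regression model: `Y_i = m(R_i) + ε_i` with `(R_i, Y_i)` i.i.d. and `E[ε_i | R_i] = 0`.
The Markov kernel `κ` is (a version of) the conditional distribution of `ε_i` given `R_i`,
so that `E[g(ε_i) | R_i = z] = ∫ g(e) κ_z(de)`. -/
structure RegressionModel {Ω : Type*} [MeasurableSpace Ω] (μ : Measure Ω) {d : ℕ}
    (R : ℕ → Ω → Fin d → ℝ) (Y ε : ℕ → Ω → ℝ) (m : (Fin d → ℝ) → ℝ)
    (κ : Kernel (Fin d → ℝ) ℝ) : Prop where
  measurable_R : ∀ i, Measurable (R i)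
  measurable_Y : ∀ i, Measurable (Y i)
  measurable_m : Measurable m
  indep : iIndepFun (fun i ω => (R i ω, Y i ω)) μ
  identDistrib : ∀ i, IdentDistrib (fun ω => (R i ω, Y i ω)) (fun ω => (R 0 ω, Y 0 ω)) μ μ
  model : ∀ i ω, Y i ω = m (R i ω) + ε i ω
  condDistrib : HasCondDistrib (ε 0) (R 0) κ μ
  condMean : ∀ᵐ z ∂(μ.map (R 0)), Integrable (fun e => e) (κ z) ∧ ∫ e, e ∂(κ z) = 0

/-- The law `ν` of the regressor has the density `f`, continuous near `r`, with `f(r) > 0`. -/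
structure DensityAssumption {d : ℕ} (ν : Measure (Fin d → ℝ)) (f : (Fin d → ℝ) → ℝ)
    (r : Fin d → ℝ) : Prop where
  measurable : Measurable f
  nonneg : ∀ z, 0 ≤ f z
  law : ν = volume.withDensity (fun z => ENNReal.ofReal (f z))
  continuousOn : ∃ U ∈ 𝓝 r, ContinuousOn f U
  pos : 0 < f r

/-- The kernel function: nonnegative, bounded, compactly supported, with total mass one and
nonsingular moment matrix `S`. There is no restriction on the shape of the support, so
the one-sided kernels `K(z) 1{z_2 ≥ 0}` and `K(z) 1{z_2 < 0}` are covered. -/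
structure KernelAssumption {d : ℕ} (p : ℕ) (K : (Fin d → ℝ) → ℝ) : Prop where
  measurable : Measurable K
  nonneg : ∀ z, 0 ≤ K z
  integral_eq_one : ∫ z, K z = 1
  bounded : ∃ C : ℝ, ∀ z, K z ≤ C
  support : ∃ C : ℝ, 0 < C ∧ ∀ z, K z ≠ 0 → ∀ k, |z k| ≤ C
  nonsingular : (momentMatrix p K).det ≠ 0

/-- The conditional variance `σ²(z) = E[ε² | R = z]`. -/
def condVar {d : ℕ} (κ : Kernel (Fin d → ℝ) ℝ) (z : Fin d → ℝ) : ℝ := ∫ e, e ^ 2 ∂(κ z)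

/-- Smoothness of the regression function near `r`, continuity of the conditional variance
at `r`, and local boundedness of a conditional moment of order `2 + δ`. -/
structure SmoothnessAssumption {d : ℕ} (p : ℕ) (m : (Fin d → ℝ) → ℝ)
    (κ : Kernel (Fin d → ℝ) ℝ) (r : Fin d → ℝ) : Prop where
  smooth : ∃ U : Set (Fin d → ℝ), IsOpen U ∧ r ∈ U ∧ ContDiffOn ℝ ((p + 1 : ℕ) : ℕ∞) m U
  variance : ContinuousAt (condVar κ) r
  moment : ∃ δ : ℝ, 0 < δ ∧ ∃ C : ℝ, ∃ U ∈ 𝓝 r, ∀ z ∈ U,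
    ∫⁻ e, ENNReal.ofReal (|e| ^ (2 + δ)) ∂(κ z) ≤ ENNReal.ofReal C

/-- The bandwidth sequences `h_1, …, h_d` (`h n` is the vector used at sample size `n`). -/
structure BandwidthAssumption {d : ℕ} (p : ℕ) (h : ℕ → Fin d → ℝ) : Prop where
  pos : ∀ n k, 0 < h n k
  tendsto_zero : ∀ k, Tendsto (fun n => h n k) atTop (𝓝 0)
  tendsto_atTop : ∀ j : MonoTuple d p,
    Tendsto (fun n : ℕ => (n : ℝ) * (∏ k, h n k) * ∏ ℓ, h n (j.1 ℓ) ^ 2) atTop atTop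
  tendsto_const : ∀ j : MonoTuple d (p + 1), ∃ c : ℝ, 0 ≤ c ∧
    Tendsto (fun n : ℕ => (n : ℝ) * (∏ k, h n k) * ∏ ℓ, h n (j.1 ℓ) ^ 2) atTop (𝓝 c)

/-- The asymptotic covariance matrix `(σ²(r)/f(r)) S⁻¹ 𝒦 S⁻¹`. -/
def asympCov {d : ℕ} (p : ℕ) (K f : (Fin d → ℝ) → ℝ) (κ : Kernel (Fin d → ℝ) ℝ)
    (r : Fin d → ℝ) : Matrix (PolyIdx d p) (PolyIdx d p) ℝ :=
  (condVar κ r / f r) • ((momentMatrix p K)⁻¹ * sqMomentMatrix p K * (momentMatrix p K)⁻¹)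

end

end LocalPoly

/-!
The proof solves the normal equations for the rescaled coefficients. Put `a = n h_1 ⋯ h_d`,
`Z_i = (R_i - r) / h`, and expand `m(R_i)` at `r` to order `p + 1`. The first-order conditions of the
weighted least-squares problem become `Ŝ T = V + E` (`sampleMoment_mulVec_scaledError`), where `T` is
the normalized estimation error of the theorem, `Ŝ` is the local average of `K φ φ'`, `V` is the
normalized sum of the weighted errors `K(Z_i) φ(Z_i) ε_i`, and `E` collects the sampling fluctuation
of the moment matrices against the scaled bias and the Taylor remainders.

* Local averages converge in probability (`tendstoInMeasure_localAvg`). The substitution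
  `x = r + h z` turns expectations of local weights into integrals that converge by dominated
  convergence (`tendsto_integral_rescale`), and the variance is of order `1 / a`. Hence `Ŝ → f(r) S`.
* `E → 0` in probability (`tendstoInMeasure_perturbation`), since `√a` times each bandwidth monomial
  of order `p + 1` converges and the Taylor remainder is of smaller order than these monomials
  (`taylor_monom`).
* `V` is asymptotically normal. A linear combination of its coordinates is a sum of a row of an
  i.i.d. array whose summands have moments of order `2 + δ`; Lyapunov's theorem in terms of
  characteristic functions (`tendsto_charFun_sum_of_lyapunov`) and Lévy's convergence theorem give
  the limit (`tendstoInDistribution_linearTerm`).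

Slutsky's theorem combines the three. Matrix inversion is not continuous everywhere, so it is applied
to a continuous function of `((f(r) S)⁻¹ V, Ŝ, E)` (`cutoffSolve`) that agrees with `T` as soon as
`|det Ŝ|` is at least half its limit, an event of probability tending to one.

The Taylor expansion is indexed by weakly increasing tuples rather than by all tuples. Passing from
one to the other takes the symmetry of the derivatives of a `C^n` function
(`iteratedFDeriv_comp_perm_of_contDiffAt`) and the count of the rearrangements of a tuple
(`card_sortTuple_fiber_mul`).
-/

namespace LocalPoly

universe u

/-! ### Symmetry of iterated derivatives -/

/-- A linear relation satisfied by a function near a point passes to its iterated derivatives. -/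
lemma iteratedFDeriv_of_eventuallyEq_clm {E G : Type*} [NormedAddCommGroup E] [NormedSpace ℝ E]
    [NormedAddCommGroup G] [NormedSpace ℝ G] {k : ℕ} {g : E → G} {x : E}
    (hg : ContDiffAt ℝ k g x) (Φ : G →L[ℝ] G) (h : g =ᶠ[𝓝 x] Φ ∘ g) (v : Fin k → E) :
    iteratedFDeriv ℝ k g x v = Φ (iteratedFDeriv ℝ k g x v) := by
  have h1 := (h.iteratedFDeriv ℝ k).eq_of_nhds.trans (Φ.iteratedFDeriv_comp_left hg le_rfl)
  exact congrArg (fun A => A v) h1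

/-- The last two arguments of an iterated derivative may be exchanged: this is the symmetry of the
second derivative, differentiated. -/
lemma iteratedFDeriv_swap_last {E F : Type u} [NormedAddCommGroup E] [NormedSpace ℝ E]
    [NormedAddCommGroup F] [NormedSpace ℝ F] {k : ℕ} {f : E → F} {x : E}
    (hf : ContDiffAt ℝ (k + 2 : ℕ) f x) (v : Fin k → E) (a b : E) :
    iteratedFDeriv ℝ k (fderiv ℝ (fderiv ℝ f)) x v a b
      = iteratedFDeriv ℝ k (fderiv ℝ (fderiv ℝ f)) x v b a := by
  obtain ⟨Φ, hΦ⟩ : ∃ Φ : (E →L[ℝ] E →L[ℝ] F) →L[ℝ] (E →L[ℝ] E →L[ℝ] F),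
      ∀ g a b, Φ g a b = g b a :=
    ⟨(ContinuousLinearMap.flipₗᵢ ℝ E E F).toContinuousLinearEquiv.toContinuousLinearMap,
      fun _ _ _ => rfl⟩
  have hev : fderiv ℝ (fderiv ℝ f) =ᶠ[𝓝 x] Φ ∘ fderiv ℝ (fderiv ℝ f) := by
    filter_upwards [hf.eventually (WithTop.coe_injective.ne (ENat.natCast_ne_top (k + 2)))] with y hy
    ext a b
    rw [Function.comp_apply, hΦ]
    refine (hy.isSymmSndFDerivAt ?_) a b
    rw [minSmoothness_of_isRCLikeNormedField]
    exact_mod_cast Nat.le_add_left 2 k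
  have hsm : ContDiffAt ℝ k (fderiv ℝ (fderiv ℝ f)) x :=
    (hf.fderiv_right (m := (k + 1 : ℕ)) (by norm_cast)).fderiv_right (by norm_cast)
  have h := iteratedFDeriv_of_eventuallyEq_clm hsm Φ hev v
  conv_lhs => rw [h]
  exact hΦ _ a b

/-- Symmetry of the `n`-th derivative of a function of class `C^n`. -/
theorem iteratedFDeriv_comp_perm_of_contDiffAt {E : Type u} [NormedAddCommGroup E]
    [NormedSpace ℝ E] (n : ℕ) : ∀ {F : Type u} [NormedAddCommGroup F] [NormedSpace ℝ F]
      {f : E → F} {x : E}, ContDiffAt ℝ n f x → ∀ (v : Fin n → E) (σ : Equiv.Perm (Fin n)),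
      iteratedFDeriv ℝ n f x (v ∘ σ) = iteratedFDeriv ℝ n f x v := by
  induction n with
  | zero =>
    intro F _ _ f x _ v σ
    congr 1
    ext i
    exact i.elim0
  | succ n ih =>
    intro F _ _ f x hf v σ
    have hσ : σ ∈ Submonoid.closure
        (Set.range fun i : Fin n => Equiv.swap i.castSucc i.succ) := by
      rw [Equiv.Perm.mclosure_swap_castSucc_succ]; trivial
    induction hσ using Submonoid.closure_induction generalizing v with
    | one => rfl
    | mul σ τ _ _ hσ hτ =>
      rw [Equiv.Perm.coe_mul, ← Function.comp_assoc, hτ, hσ]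
    | mem σ hσ =>
      obtain ⟨i, rfl⟩ := hσ
      cases n with
      | zero => exact i.elim0
      | succ k =>
        have hf' : ContDiffAt ℝ (k + 1 : ℕ) (fderiv ℝ f) x := hf.fderiv_right (by norm_cast)
        refine Fin.lastCases ?_ (fun j => ?_) i
        · rw [iteratedFDeriv_succ_apply_right, iteratedFDeriv_succ_apply_right,
            iteratedFDeriv_succ_apply_right, iteratedFDeriv_succ_apply_right,
            iteratedFDeriv_swap_last hf]
          have h1 : Fin.init (Fin.init (v ∘ ⇑(Equiv.swap (Fin.last k).castSucc (Fin.last k).succ)))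
              = Fin.init (Fin.init v) := by
            ext l
            simp only [Fin.init, Function.comp_apply]
            rw [Equiv.swap_apply_of_ne_of_ne]
            · exact fun h => (Fin.castSucc_lt_last l).ne (Fin.castSucc_injective _ h)
            · rw [Fin.succ_last]
              exact (Fin.castSucc_lt_last _).ne
          rw [h1]
          simp [Fin.init]
        · rw [iteratedFDeriv_succ_apply_right, iteratedFDeriv_succ_apply_right (m := v)]
          have h1 : Fin.init (v ∘ ⇑(Equiv.swap j.castSucc.castSucc j.castSucc.succ))
              = Fin.init v ∘ Equiv.swap j.castSucc j.succ := by
            ext l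
            simp only [Fin.init, Function.comp_apply]
            rw [Fin.succ_castSucc, Fin.castSucc_injective _ |>.map_swap]
          have h2 : (v ∘ ⇑(Equiv.swap j.castSucc.castSucc j.castSucc.succ)) (Fin.last (k + 1))
              = v (Fin.last (k + 1)) := by
            rw [Function.comp_apply, Equiv.swap_apply_of_ne_of_ne]
            · exact (Fin.castSucc_lt_last _).ne'
            · rw [Fin.succ_castSucc]
              exact (Fin.castSucc_lt_last _).ne'
          rw [h1, h2, ih hf']

/-! ### Taylor expansion in monomials indexed by weakly increasing tuples -/

/-- The weakly increasing rearrangement of an index tuple. -/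
def sortTuple {d L : ℕ} (i : Fin L → Fin d) : MonoTuple d L :=
  ⟨i ∘ Tuple.sort i, Tuple.monotone_sort i⟩

lemma multFactorial_pos {d L : ℕ} (j : Fin L → Fin d) : 0 < multFactorial j :=
  Finset.prod_pos fun _ _ => Nat.factorial_pos _

/-- Orbit counting: the permutations of the positions act transitively on the rearrangements of
`j`, and `s_j!` of them fix `j`. -/
lemma card_sortTuple_fiber_mul {d L : ℕ} (j : MonoTuple d L) :
    (Finset.univ.filter fun i : Fin L → Fin d => sortTuple i = j).card * multFactorial j.1
      = L.factorial := by
  classical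
  have hmaps : ∀ σ ∈ (Finset.univ : Finset (Equiv.Perm (Fin L))),
      j.1 ∘ σ ∈ Finset.univ.filter fun i : Fin L → Fin d => sortTuple i = j := by
    intro σ _
    refine Finset.mem_coe.2 (Finset.mem_filter.2 ⟨Finset.mem_univ _, Subtype.ext ?_⟩)
    change (j.1 ∘ σ) ∘ Tuple.sort (j.1 ∘ σ) = j.1
    rw [Tuple.comp_perm_comp_sort_eq_comp_sort, Tuple.sort_eq_refl_iff_monotone.2 j.2]
    rfl
  have hcard := Finset.card_eq_sum_card_fiberwise hmaps
  have hfib : ∀ i ∈ Finset.univ.filter (fun i : Fin L → Fin d => sortTuple i = j),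
      (Finset.univ.filter fun σ : Equiv.Perm (Fin L) => j.1 ∘ σ = i).card
        = multFactorial j.1 := by
    intro i hi
    have hi' : i ∘ Tuple.sort i = j.1 := congrArg Subtype.val (Finset.mem_filter.1 hi).2
    have hst : (Finset.univ.filter fun g : Equiv.Perm (Fin L) => j.1 ∘ g = j.1).card
        = multFactorial j.1 := by
      rw [← Fintype.card_subtype, DomMulAct.stabilizer_card]
      simp [multFactorial, Fintype.card_subtype]
    rw [← hst]
    refine Finset.card_nbij' (fun σ => σ * Tuple.sort i) (fun g => g * (Tuple.sort i)⁻¹) ?_ ?_ ?_ ?_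
    · intro σ hσ
      have hσ' : j.1 ∘ σ = i := by simpa using hσ
      have : j.1 ∘ ⇑(σ * Tuple.sort i) = j.1 := by
        rw [Equiv.Perm.coe_mul, ← Function.comp_assoc, hσ', hi']
      simpa using this
    · intro g hg
      have hg' : j.1 ∘ g = j.1 := by simpa using hg
      have : j.1 ∘ ⇑(g * (Tuple.sort i)⁻¹) = i := by
        rw [Equiv.Perm.coe_mul, ← Function.comp_assoc, hg', ← hi', Function.comp_assoc]
        ext x
        simp
      simpa using this
    · intro σ _; simp
    · intro g _; simp
  rw [Finset.sum_congr rfl hfib, Finset.sum_const, smul_eq_mul, Finset.card_univ,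
    Fintype.card_perm, Fintype.card_fin] at hcard
  exact hcard.symm

/-- A symmetric function of index tuples is summed by listing the weakly increasing tuples with
their multiplicities. -/
lemma sum_tuple_eq_sum_monoTuple {d L : ℕ} (F : (Fin L → Fin d) → ℝ)
    (hF : ∀ i (σ : Equiv.Perm (Fin L)), F (i ∘ σ) = F i) :
    (L.factorial : ℝ)⁻¹ * ∑ i, F i = ∑ j : MonoTuple d L, F j.1 / (multFactorial j.1 : ℝ) := by
  classical
  rw [← Finset.sum_fiberwise (s := Finset.univ) (g := sortTuple), Finset.mul_sum]
  refine Finset.sum_congr rfl fun j _ => ?_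
  have hfib : ∀ i ∈ Finset.univ.filter (fun i : Fin L → Fin d => sortTuple i = j),
      F i = F j.1 := by
    intro i hi
    rw [← congrArg Subtype.val (Finset.mem_filter.1 hi).2]
    exact (hF i _).symm
  rw [Finset.sum_congr rfl hfib, Finset.sum_const, nsmul_eq_mul]
  have h := card_sortTuple_fiber_mul j
  have h1 : (multFactorial j.1 : ℝ) ≠ 0 := by exact_mod_cast (multFactorial_pos j.1).ne'
  have h2 : (L.factorial : ℝ) ≠ 0 := by exact_mod_cast L.factorial_ne_zero
  have h3 : ((Finset.univ.filter fun i : Fin L → Fin d => sortTuple i = j).card : ℝ)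
      * (multFactorial j.1 : ℝ) = L.factorial := by exact_mod_cast h
  field_simp
  rw [← h3]; ring

lemma monom_comp_perm {d L : ℕ} (j : Fin L → Fin d) (σ : Equiv.Perm (Fin L)) (z : Fin d → ℝ) :
    monom (j ∘ σ) z = monom j z :=
  Equiv.prod_comp σ fun ℓ => z (j ℓ)

/-- The diagonal of the `L`-th derivative in monomial form. -/
lemma iteratedFDeriv_diag_eq_sum {d L : ℕ} {m : (Fin d → ℝ) → ℝ} {r : Fin d → ℝ}
    (hm : ContDiffAt ℝ L m r) (v : Fin d → ℝ) :
    (L.factorial : ℝ)⁻¹ * iteratedFDeriv ℝ L m r (fun _ => v)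
      = ∑ j : MonoTuple d L, partialD j.1 m r / (multFactorial j.1 : ℝ) * monom j.1 v := by
  have hv : v = ∑ k, v k • (Pi.single k (1 : ℝ) : Fin d → ℝ) := by
    ext k; simp [Finset.sum_apply, Pi.single_apply]
  have hexp : iteratedFDeriv ℝ L m r (fun _ => v)
      = ∑ i : Fin L → Fin d, monom i v * partialD i m r := by
    conv_lhs => rw [hv]
    rw [ContinuousMultilinearMap.map_sum]
    refine Finset.sum_congr rfl fun i _ => ?_
    rw [ContinuousMultilinearMap.map_smul_univ]
    rfl
  rw [hexp, sum_tuple_eq_sum_monoTuple (fun i => monom i v * partialD i m r)]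
  · exact Finset.sum_congr rfl fun j _ => by ring
  · intro i σ
    simp only [monom_comp_perm]
    congr 1
    exact iteratedFDeriv_comp_perm_of_contDiffAt L hm
      (fun ℓ => (Pi.single (i ℓ) (1 : ℝ) : Fin d → ℝ)) σ

lemma sum_polyIdx {d p : ℕ} (F : (L : ℕ) → MonoTuple d L → ℝ) :
    ∑ a : PolyIdx d p, F a.1 a.2 = ∑ L ∈ Finset.range (p + 1), ∑ j : MonoTuple d L, F L j := by
  rw [Fintype.sum_sigma, Finset.sum_range]

/-- **Multivariate Taylor expansion** of order `p + 1` with a remainder of smaller order, in the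
monomial coordinates of the estimator. -/
lemma taylor_monom {d p : ℕ} {m : (Fin d → ℝ) → ℝ} {r : Fin d → ℝ} {U : Set (Fin d → ℝ)}
    (hU : IsOpen U) (hr : r ∈ U) (hm : ContDiffOn ℝ ((p + 1 : ℕ) : ℕ∞) m U)
    {η : ℝ} (hη : 0 < η) :
    ∃ ρ > 0, ∀ v : Fin d → ℝ, ‖v‖ < ρ →
      |m (r + v) - ∑ a : PolyIdx d p, derivVec p m r a * monom a.2.1 v
        - ∑ b : MonoTuple d (p + 1), partialD b.1 m r / (multFactorial b.1 : ℝ) * monom b.1 v|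
        ≤ η * ‖v‖ ^ (p + 1) := by
  have hat : ∀ x ∈ U, ContDiffAt ℝ ((p + 1 : ℕ) : ℕ∞) m x := fun x hx =>
    hm.contDiffAt (hU.mem_nhds hx)
  have hcont : ContinuousAt (iteratedFDeriv ℝ (p + 1) m) r :=
    (hat r hr).continuousAt_iteratedFDeriv le_rfl
  obtain ⟨ρ₁, hρ₁, hball⟩ := Metric.isOpen_iff.1 hU r hr
  obtain ⟨ρ₂, hρ₂, hclose⟩ := Metric.continuousAt_iff.1 hcont η hη
  refine ⟨min ρ₁ ρ₂, lt_min hρ₁ hρ₂, fun v hv => ?_⟩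
  have hseg : ∀ t ∈ Set.Icc (0 : ℝ) 1, dist (r + t • v) r < min ρ₁ ρ₂ := by
    intro t ht
    rw [dist_eq_norm, add_sub_cancel_left, norm_smul, Real.norm_of_nonneg ht.1]
    exact (mul_le_of_le_one_left (norm_nonneg v) ht.2).trans_lt hv
  have hT := map_add_eq_sum_add_integral_iteratedFDeriv (f := m) (x := r) (y := v) (n := p)
    fun t ht => by
      simpa using hat _ (hball ((hseg t ht).trans_le (min_le_left _ _)))
  set D := iteratedFDeriv ℝ (p + 1) m r (fun _ => v) with hD
  have hlow : ∑ k ∈ Finset.range (p + 1),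
      (k.factorial : ℝ)⁻¹ • iteratedFDeriv ℝ k m r (fun _ => v)
        = ∑ a : PolyIdx d p, derivVec p m r a * monom a.2.1 v := by
    refine Eq.trans (Finset.sum_congr rfl fun k hk => ?_)
      (sum_polyIdx fun L j => partialD j.1 m r / (multFactorial j.1 : ℝ) * monom j.1 v).symm
    have hk' : k ≤ p + 1 := (Finset.mem_range.1 hk).le
    exact iteratedFDeriv_diag_eq_sum ((hat r hr).of_le (by exact_mod_cast hk')) v
  have htop := iteratedFDeriv_diag_eq_sum (L := p + 1) ((hat r hr).of_le (by simp)) v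
  -- The weights `(1 - t) ^ p / p!` integrate to `1 / (p + 1)!`, which isolates the top-order term.
  have hw : (p.factorial : ℝ)⁻¹ * ∫ t in (0 : ℝ)..1, (1 - t) ^ p * D
      = ((p + 1).factorial : ℝ)⁻¹ * D := by
    have h1 : ∫ t in (0 : ℝ)..1, (1 - t) ^ p = ((p : ℝ) + 1)⁻¹ := by
      rw [intervalIntegral.integral_comp_sub_left (fun t => t ^ p) (1 : ℝ)]
      simp [integral_pow]
    rw [intervalIntegral.integral_mul_const, h1, Nat.factorial_succ]
    push_cast
    rw [mul_inv]; ring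
  have hDcont : ContinuousOn
      (fun t : ℝ => iteratedFDeriv ℝ (p + 1) m (r + t • v) (fun _ => v)) (Set.uIcc 0 1) := by
    intro t ht
    rw [Set.uIcc_of_le zero_le_one] at ht
    have h1 : ContinuousAt (iteratedFDeriv ℝ (p + 1) m) (r + t • v) :=
      (hat _ (hball ((hseg t ht).trans_le (min_le_left _ _)))).continuousAt_iteratedFDeriv le_rfl
    have h2 : ContinuousAt (fun t : ℝ => r + t • v) t := by fun_prop
    have h3 : ContinuousAt (fun t : ℝ => iteratedFDeriv ℝ (p + 1) m (r + t • v)) t :=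
      ContinuousAt.comp (f := fun t : ℝ => r + t • v) h1 h2
    exact ((ContinuousMultilinearMap.apply ℝ (fun _ : Fin (p + 1) => Fin d → ℝ) ℝ
      (fun _ => v)).continuous.continuousAt.comp h3).continuousWithinAt
  have hi1 : IntervalIntegrable
      (fun t : ℝ => (1 - t) ^ p * iteratedFDeriv ℝ (p + 1) m (r + t • v) (fun _ => v))
      volume 0 1 :=
    ContinuousOn.intervalIntegrable ((by fun_prop : Continuous fun t : ℝ => (1 - t) ^ p).continuousOn.mul hDcont)
  have hi2 : IntervalIntegrable (fun t : ℝ => (1 - t) ^ p * D) volume 0 1 :=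
    Continuous.intervalIntegrable (by fun_prop) _ _
  have hrem : m (r + v) - ∑ a : PolyIdx d p, derivVec p m r a * monom a.2.1 v
      - ∑ b : MonoTuple d (p + 1), partialD b.1 m r / (multFactorial b.1 : ℝ) * monom b.1 v
      = (p.factorial : ℝ)⁻¹ * ∫ t in (0 : ℝ)..1, ((1 - t) ^ p *
          iteratedFDeriv ℝ (p + 1) m (r + t • v) (fun _ => v) - (1 - t) ^ p * D) := by
    rw [intervalIntegral.integral_sub hi1 hi2, mul_sub, hw, hT, hlow, ← htop]
    simp only [smul_eq_mul]
    ring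
  rw [hrem, abs_mul, abs_of_nonneg (by positivity)]
  have hbound : ‖∫ t in (0 : ℝ)..1, ((1 - t) ^ p *
          iteratedFDeriv ℝ (p + 1) m (r + t • v) (fun _ => v) - (1 - t) ^ p * D)‖
      ≤ (η * ‖v‖ ^ (p + 1)) * |1 - 0| := by
    refine intervalIntegral.norm_integral_le_of_norm_le_const fun t ht => ?_
    rw [Set.uIoc_of_le zero_le_one] at ht
    have ht' : t ∈ Set.Icc (0 : ℝ) 1 := ⟨ht.1.le, ht.2⟩
    have h1 := (hclose ((hseg t ht').trans_le (min_le_right _ _))).le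
    rw [dist_eq_norm] at h1
    have h2 := (iteratedFDeriv ℝ (p + 1) m (r + t • v)
      - iteratedFDeriv ℝ (p + 1) m r).le_opNorm (fun _ => v)
    rw [Finset.prod_const, Finset.card_univ, Fintype.card_fin,
      _root_.sub_apply] at h2
    rw [← mul_sub, norm_mul, Real.norm_of_nonneg (pow_nonneg (by linarith [ht.2]) p)]
    refine (mul_le_of_le_one_left (norm_nonneg _)
      (pow_le_one₀ (by linarith [ht.2]) (by linarith [ht.1]))).trans (h2.trans ?_)
    gcongr
  rw [Real.norm_eq_abs] at hbound
  have hfac : (p.factorial : ℝ)⁻¹ ≤ 1 :=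
    inv_le_one_of_one_le₀ (by exact_mod_cast Nat.one_le_iff_ne_zero.2 p.factorial_ne_zero)
  refine (mul_le_of_le_one_left (abs_nonneg _) hfac).trans (hbound.trans ?_)
  simp

end LocalPoly

namespace LocalPoly

/-! ### Local weights -/

/-- A weight function for local averages: measurable, bounded, and zero outside a cube. -/
structure IsLocalWeight {d : ℕ} (G : (Fin d → ℝ) → ℝ) : Prop where
  measurable : Measurable G
  bounded : ∃ C : ℝ, 0 ≤ C ∧ ∀ z, |G z| ≤ C
  support : ∃ c : ℝ, 0 < c ∧ ∀ z, G z ≠ 0 → ∀ k, |z k| ≤ c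

namespace IsLocalWeight

variable {d : ℕ} {G : (Fin d → ℝ) → ℝ}

lemma eq_zero_of_norm (hG : IsLocalWeight G) :
    ∃ c : ℝ, 0 < c ∧ ∀ z, G z ≠ 0 → ‖z‖ ≤ c := by
  obtain ⟨c, hc, h⟩ := hG.support
  exact ⟨c, hc, fun z hz => (pi_norm_le_iff_of_nonneg hc.le).2 fun k => h z hz k⟩

lemma mul_continuous (hG : IsLocalWeight G) {q : (Fin d → ℝ) → ℝ} (hq : Continuous q) :
    IsLocalWeight fun z => G z * q z := by
  obtain ⟨c, hc, hsupp⟩ := hG.eq_zero_of_norm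
  obtain ⟨C, hC, hb⟩ := hG.bounded
  obtain ⟨Q, hQ⟩ := (isCompact_closedBall (0 : Fin d → ℝ) c).exists_bound_of_continuousOn
    hq.continuousOn
  refine ⟨hG.measurable.mul hq.measurable, ⟨C * |Q|, by positivity, fun z => ?_⟩, ?_⟩
  · by_cases hz : G z = 0
    · simp only [hz, zero_mul, abs_zero]; positivity
    · rw [abs_mul]
      exact mul_le_mul (hb z) ((hQ z (by simpa using hsupp z hz)).trans (le_abs_self Q))
        (abs_nonneg _) hC
  · obtain ⟨c, hc, hs⟩ := hG.support
    exact ⟨c, hc, fun z hz => hs z (left_ne_zero_of_mul hz)⟩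

/-- Composition with a continuous function that vanishes at the origin. -/
lemma comp_continuous (hG : IsLocalWeight G) {g : ℝ → ℝ} (hg : Continuous g) (h0 : g 0 = 0) :
    IsLocalWeight fun z => g (G z) := by
  obtain ⟨C, hC, hb⟩ := hG.bounded
  obtain ⟨c, hc, hs⟩ := hG.support
  obtain ⟨Q, hQ⟩ := (isCompact_Icc (a := -C) (b := C)).exists_bound_of_continuousOn
    hg.continuousOn
  refine ⟨hg.measurable.comp hG.measurable, ⟨|Q|, abs_nonneg _, fun z => ?_⟩, ⟨c, hc, ?_⟩⟩
  · exact (hQ _ (abs_le.1 (hb z))).trans (le_abs_self Q)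
  · intro z hz
    refine hs z fun h => hz ?_
    rw [h, h0]

lemma abs (hG : IsLocalWeight G) : IsLocalWeight fun z => |G z| :=
  hG.comp_continuous continuous_abs abs_zero

lemma sq (hG : IsLocalWeight G) : IsLocalWeight fun z => G z ^ 2 :=
  hG.comp_continuous (continuous_pow 2) (by simp)

lemma integrable (hG : IsLocalWeight G) : Integrable G := by
  obtain ⟨c, hc, hsupp⟩ := hG.eq_zero_of_norm
  obtain ⟨C, hC, hb⟩ := hG.bounded
  have h : IntegrableOn G (Metric.closedBall 0 c) :=
    Measure.integrableOn_of_bounded (M := C) measure_closedBall_lt_top.ne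
      hG.measurable.aestronglyMeasurable (ae_of_all _ hb)
  rw [← integrableOn_univ]
  refine h.of_forall_sdiff_eq_zero MeasurableSet.univ fun z hz => ?_
  by_contra hne
  exact hz.2 (by simpa using hsupp z hne)

end IsLocalWeight

lemma continuous_monom {d L : ℕ} (j : Fin L → Fin d) : Continuous (monom j) :=
  continuous_finsetProd _ fun ℓ _ => continuous_apply (j ℓ)

/-! ### Kernel smoothing -/

lemma measurable_rescale {d : ℕ} (h r : Fin d → ℝ) : Measurable (rescale h r) :=
  measurable_pi_lambda _ fun k => ((measurable_pi_apply k).sub_const _).div_const _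

/-- The change of variables `x = r + h z`. -/
lemma integral_eq_prod_mul_integral_rescale {d : ℕ} {h : Fin d → ℝ} (hh : ∀ k, 0 < h k)
    (r : Fin d → ℝ) (Φ : (Fin d → ℝ) → ℝ) (hΦ : Measurable Φ) :
    ∫ x, Φ x = (∏ k, h k) * ∫ z : Fin d → ℝ, Φ (fun k => r k + h k * z k) := by
  have hprod : 0 < ∏ k, h k := Finset.prod_pos fun k _ => hh k
  have hdet : (Matrix.diagonal h).det ≠ 0 := by
    rw [Matrix.det_diagonal]; exact hprod.ne'
  have hvol := Real.smul_map_diagonal_volume_pi hdet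
  rw [Matrix.det_diagonal, abs_of_pos hprod] at hvol
  rw [← integral_add_right_eq_self Φ r]
  conv_lhs => rw [← hvol]
  have hmeas : Measurable (Matrix.toLin' (Matrix.diagonal h)) :=
    (LinearMap.continuous_on_pi _).measurable
  have hΦr : Measurable fun x => Φ (x + r) := hΦ.comp (measurable_add_const r)
  rw [integral_smul_measure, ENNReal.toReal_ofReal hprod.le, smul_eq_mul,
    integral_map hmeas.aemeasurable hΦr.aestronglyMeasurable]
  congr 1
  refine integral_congr_ae (ae_of_all _ fun z => ?_)
  simp only
  congr 1
  ext k
  simp [Matrix.mulVec_diagonal, add_comm]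

lemma rescale_affine {d : ℕ} {h : Fin d → ℝ} (hh : ∀ k, 0 < h k) (r z : Fin d → ℝ) :
    rescale h r (fun k => r k + h k * z k) = z := by
  ext k
  have := (hh k).ne'
  simp only [rescale]
  field_simp
  ring

lemma tendsto_affine {d : ℕ} {h : ℕ → Fin d → ℝ} (h0 : ∀ k, Tendsto (fun n => h n k) atTop (𝓝 0))
    (r z : Fin d → ℝ) : Tendsto (fun n => fun k => r k + h n k * z k) atTop (𝓝 r) := by
  rw [tendsto_pi_nhds]
  intro k
  simpa using tendsto_const_nhds.add ((h0 k).mul_const (z k))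

/-- As the bandwidths vanish, observations with nonzero weight concentrate at `r`. -/
lemma eventually_support_subset {d : ℕ} {h : ℕ → Fin d → ℝ} (hpos : ∀ n k, 0 < h n k)
    (h0 : ∀ k, Tendsto (fun n => h n k) atTop (𝓝 0)) {G : (Fin d → ℝ) → ℝ}
    (hG : IsLocalWeight G) {r : Fin d → ℝ} {U : Set (Fin d → ℝ)} (hU : U ∈ 𝓝 r) :
    ∀ᶠ n in atTop, ∀ x, G (rescale (h n) r x) ≠ 0 → x ∈ U := by
  obtain ⟨c, hc, hs⟩ := hG.support
  obtain ⟨ρ, hρ, hball⟩ := Metric.mem_nhds_iff.1 hU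
  have hsmall : ∀ᶠ n in atTop, ∀ k, h n k < ρ / c :=
    eventually_all.2 fun k => (h0 k).eventually_lt_const (by positivity)
  filter_upwards [hsmall] with n hn x hx
  refine hball ?_
  rw [Metric.mem_ball, dist_pi_lt_iff hρ]
  intro k
  have h1 := hs _ hx k
  rw [rescale, abs_div, abs_of_pos (hpos n k), div_le_iff₀ (hpos n k)] at h1
  rw [Real.dist_eq]
  calc |x k - r k| ≤ c * h n k := h1
    _ < c * (ρ / c) := by gcongr; exact hn k
    _ = ρ := by field_simp

section Smoothing

variable {d : ℕ} {ν : Measure (Fin d → ℝ)} {f : (Fin d → ℝ) → ℝ} {r : Fin d → ℝ}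
  {h : ℕ → Fin d → ℝ}

/-- **Kernel smoothing**: local averages of a function continuous at `r` converge to its value
at `r` times the density. -/
lemma tendsto_integral_rescale (hf : DensityAssumption ν f r) (hpos : ∀ n k, 0 < h n k)
    (h0 : ∀ k, Tendsto (fun n => h n k) atTop (𝓝 0)) {G : (Fin d → ℝ) → ℝ}
    (hG : IsLocalWeight G) {F : (Fin d → ℝ) → ℝ} (hF : Measurable F) (hFr : ContinuousAt F r) :
    Tendsto (fun n => (∏ k, h n k)⁻¹ * ∫ x, G (rescale (h n) r x) * F x ∂ν) atTop
      (𝓝 (f r * F r * ∫ z, G z)) := by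
  have hfr : ContinuousAt f r := by
    obtain ⟨U, hU, hc⟩ := hf.continuousOn
    exact hc.continuousAt hU
  have hFf : ContinuousAt (fun x => f x * F x) r := hfr.mul hFr
  have hFfm : Measurable fun x => f x * F x := hf.measurable.mul hF
  have heq : ∀ n, (∏ k, h n k)⁻¹ * ∫ x, G (rescale (h n) r x) * F x ∂ν
      = ∫ z : Fin d → ℝ, (f (fun k => r k + h n k * z k) * F (fun k => r k + h n k * z k)) * G z := by
    intro n
    rw [hf.law, integral_withDensity_eq_integral_toReal_smul hf.measurable.ennreal_ofReal
      (ae_of_all _ fun _ => ENNReal.ofReal_lt_top)]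
    rw [integral_eq_prod_mul_integral_rescale (hpos n) r, ← mul_assoc,
      inv_mul_cancel₀ (Finset.prod_pos fun k _ => hpos n k).ne', one_mul]
    · refine integral_congr_ae (ae_of_all _ fun z => ?_)
      simp only [rescale_affine (hpos n), ENNReal.toReal_ofReal (hf.nonneg _), smul_eq_mul]
      ring
    · exact hf.measurable.ennreal_ofReal.ennreal_toReal.smul
        ((hG.measurable.comp (measurable_rescale _ _)).mul hF)
  simp_rw [heq]
  rw [← integral_const_mul]
  have hbd : ∀ᶠ x in 𝓝 r, ‖f x * F x‖ ≤ ‖f r * F r‖ + 1 :=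
    (hFf.norm.eventually_le_const (lt_add_one _))
  refine tendsto_integral_filter_of_dominated_convergence
    (fun z => (‖f r * F r‖ + 1) * |G z|) ?_ ?_ (hG.abs.integrable.const_mul _) ?_
  · refine Eventually.of_forall fun n => ?_
    refine Measurable.aestronglyMeasurable ?_
    exact (hFfm.comp (measurable_pi_lambda _ fun k =>
      ((measurable_pi_apply k).const_mul _).const_add _)).mul hG.measurable
  · filter_upwards [eventually_support_subset hpos h0 hG hbd] with n hn
    refine ae_of_all _ fun z => ?_
    rw [norm_mul, Real.norm_eq_abs (G z)]
    by_cases hz : G z = 0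
    · simp [hz]
    · gcongr
      refine hn _ ?_
      rwa [rescale_affine (hpos n)]
  · refine ae_of_all _ fun z => ?_
    exact (hFf.tendsto.comp (tendsto_affine h0 r z)).mul_const _

end Smoothing

/-! ### Calculus of convergence in probability -/

section InMeasure

variable {Ω : Type*} [MeasurableSpace Ω] {μ : Measure Ω}

lemma tendstoInMeasure_zero_iff {X : ℕ → Ω → ℝ} :
    TendstoInMeasure μ X atTop (fun _ => (0 : ℝ)) ↔
      ∀ e : ℝ, 0 < e → Tendsto (fun n => μ {ω | e ≤ |X n ω|}) atTop (𝓝 0) := by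
  simp [tendstoInMeasure_iff_norm]

lemma tendstoInMeasure_zero_add {X Y : ℕ → Ω → ℝ}
    (hX : TendstoInMeasure μ X atTop (fun _ => (0 : ℝ)))
    (hY : TendstoInMeasure μ Y atTop (fun _ => (0 : ℝ))) :
    TendstoInMeasure μ (fun n ω => X n ω + Y n ω) atTop (fun _ => (0 : ℝ)) := by
  rw [tendstoInMeasure_zero_iff] at *
  intro e he
  have h := (hX (e / 2) (by positivity)).add (hY (e / 2) (by positivity))
  rw [add_zero] at h
  refine tendsto_of_tendsto_of_tendsto_of_le_of_le tendsto_const_nhds h (fun _ => zero_le)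
    fun n => (measure_mono fun ω hω => ?_).trans (measure_union_le _ _)
  by_contra hcon
  simp only [Set.mem_union, Set.mem_ofPred_eq, not_or, not_le] at hcon hω
  linarith [abs_add_le (X n ω) (Y n ω)]

lemma tendstoInMeasure_zero_sum {ι : Type*} (s : Finset ι) {X : ι → ℕ → Ω → ℝ}
    (hX : ∀ i ∈ s, TendstoInMeasure μ (X i) atTop (fun _ => (0 : ℝ))) :
    TendstoInMeasure μ (fun n ω => ∑ i ∈ s, X i n ω) atTop (fun _ => (0 : ℝ)) := by
  classical
  induction s using Finset.induction_on with
  | empty =>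
    rw [tendstoInMeasure_zero_iff]
    intro e he
    simp [not_le.2 he]
  | insert i s hi ih =>
    simp_rw [Finset.sum_insert hi]
    exact tendstoInMeasure_zero_add (hX i (Finset.mem_insert_self _ _))
      (ih fun j hj => hX j (Finset.mem_insert_of_mem hj))

/-- Domination by a convergent deterministic factor times a null sequence. -/
lemma tendstoInMeasure_zero_of_le_mul {X A : ℕ → Ω → ℝ} {b : ℕ → ℝ} {c : ℝ}
    (hb : Tendsto b atTop (𝓝 c)) (hA : TendstoInMeasure μ A atTop (fun _ => (0 : ℝ)))
    (hle : ∀ᶠ n in atTop, ∀ ω, |X n ω| ≤ |b n| * |A n ω|) :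
    TendstoInMeasure μ X atTop (fun _ => (0 : ℝ)) := by
  rw [tendstoInMeasure_zero_iff] at *
  intro e he
  have hbc : ∀ᶠ n in atTop, |b n| < |c| + 1 := hb.abs.eventually_lt_const (lt_add_one _)
  refine tendsto_of_tendsto_of_tendsto_of_le_of_le' tendsto_const_nhds
    (hA (e / (|c| + 1)) (by positivity)) (Eventually.of_forall fun _ => zero_le) ?_
  filter_upwards [hbc, hle] with n hn hn'
  refine measure_mono fun ω hω => ?_
  simp only [Set.mem_ofPred_eq] at hω ⊢
  rw [div_le_iff₀ (by positivity), mul_comm]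
  exact hω.trans ((hn' ω).trans (by gcongr))

lemma tendstoInMeasure_sub_const {X : ℕ → Ω → ℝ} {c : ℝ}
    (hX : TendstoInMeasure μ X atTop (fun _ => c)) :
    TendstoInMeasure μ (fun n ω => X n ω - c) atTop (fun _ => (0 : ℝ)) := by
  simpa [tendstoInMeasure_iff_norm] using hX

lemma tendstoInMeasure_zero_mul {A : ℕ → Ω → ℝ} {b : ℕ → ℝ} {c : ℝ}
    (hb : Tendsto b atTop (𝓝 c)) (hA : TendstoInMeasure μ A atTop (fun _ => (0 : ℝ))) :
    TendstoInMeasure μ (fun n ω => A n ω * b n) atTop (fun _ => (0 : ℝ)) :=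
  tendstoInMeasure_zero_of_le_mul hb hA
    (Eventually.of_forall fun n ω => by rw [abs_mul, mul_comm])

/-- Domination by an arbitrarily small factor times a sequence that converges in probability. -/
lemma tendstoInMeasure_zero_of_le_small_mul {X A : ℕ → Ω → ℝ} {c : ℝ}
    (hA : TendstoInMeasure μ A atTop (fun _ => c))
    (hle : ∀ η > 0, ∀ᶠ n in atTop, ∀ ω, |X n ω| ≤ η * |A n ω|) :
    TendstoInMeasure μ X atTop (fun _ => (0 : ℝ)) := by
  rw [tendstoInMeasure_zero_iff]
  rw [tendstoInMeasure_iff_norm] at hA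
  intro e he
  have hη : 0 < e / (|c| + 2) := by positivity
  refine tendsto_of_tendsto_of_tendsto_of_le_of_le' tendsto_const_nhds
    (hA 1 one_pos) (Eventually.of_forall fun _ => zero_le) ?_
  filter_upwards [hle _ hη] with n hn
  refine measure_mono fun ω hω => ?_
  simp only [Set.mem_ofPred_eq, Real.norm_eq_abs] at hω ⊢
  by_contra hcon
  have h1 : |A n ω| < |c| + 2 := by
    have := abs_sub_abs_le_abs_sub (A n ω) c
    linarith
  have h2 : e / (|c| + 2) * |A n ω| < e := by
    rw [div_mul_eq_mul_div, div_lt_iff₀ (by positivity)]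
    exact mul_lt_mul_of_pos_left h1 he
  linarith [hn ω]

/-- Convergence in probability of finitely many coordinates is joint. -/
lemma tendstoInMeasure_pi {ι : Type*} [Fintype ι] {X : ℕ → Ω → ι → ℝ} {c : ι → ℝ}
    (hX : ∀ i, TendstoInMeasure μ (fun n ω => X n ω i) atTop (fun _ => c i)) :
    TendstoInMeasure μ X atTop (fun _ => c) := by
  simp only [tendstoInMeasure_iff_norm] at *
  intro e he
  have hlim := tendsto_finsetSum (Finset.univ : Finset ι) fun i _ => hX i e he
  rw [Finset.sum_const_zero] at hlim
  refine tendsto_of_tendsto_of_tendsto_of_le_of_le tendsto_const_nhds hlim (fun _ => zero_le)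
    fun n => (measure_mono fun ω hω => ?_).trans
      (measure_biUnion_finset_le Finset.univ fun i => {ω | e ≤ ‖X n ω i - c i‖})
  simp only [Set.mem_iUnion, Set.mem_ofPred_eq, Finset.mem_univ, exists_prop, true_and] at hω ⊢
  by_contra! hcon
  exact absurd hω (not_le.2 ((pi_norm_lt_iff he).2 hcon))

end InMeasure

/-! ### Local averages of the sample -/

section LocalAverage

variable {Ω : Type*} [MeasurableSpace Ω] {μ : Measure Ω} [IsProbabilityMeasure μ]
  {d : ℕ} {R : ℕ → Ω → Fin d → ℝ} {f : (Fin d → ℝ) → ℝ} {r : Fin d → ℝ} {h : ℕ → Fin d → ℝ}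

/-- The effective sample size `n h_1 ⋯ h_d`. -/
noncomputable def effSize {d : ℕ} (h : ℕ → Fin d → ℝ) (n : ℕ) : ℝ := (n : ℝ) * ∏ k, h n k

/-- The local average `(n h_1 ⋯ h_d)⁻¹ ∑_{i < n} G((R_i - r) / h)`. -/
noncomputable def localAvg {Ω : Type*} {d : ℕ} (G : (Fin d → ℝ) → ℝ) (h : ℕ → Fin d → ℝ)
    (r : Fin d → ℝ) (R : ℕ → Ω → Fin d → ℝ) (n : ℕ) (ω : Ω) : ℝ :=
  (effSize h n)⁻¹ * ∑ i ∈ Finset.range n, G (rescale (h n) r (R i ω))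

/-- **Local law of large numbers**: the bias is controlled by kernel smoothing, the variance is of
order `1 / (n h_1 ⋯ h_d)`. -/
lemma tendstoInMeasure_localAvg (hRm : ∀ i, Measurable (R i)) (hind : iIndepFun R μ)
    (hid : ∀ i, IdentDistrib (R i) (R 0) μ μ) (hf : DensityAssumption (μ.map (R 0)) f r)
    (hpos : ∀ n k, 0 < h n k) (h0 : ∀ k, Tendsto (fun n => h n k) atTop (𝓝 0))
    (ha : Tendsto (effSize h) atTop atTop) {G : (Fin d → ℝ) → ℝ} (hG : IsLocalWeight G) :
    TendstoInMeasure μ (localAvg G h r R) atTop (fun _ => f r * ∫ z, G z) := by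
  obtain ⟨C, hC, hb⟩ := hG.bounded
  have hgm : ∀ n, Measurable fun x => G (rescale (h n) r x) := fun n =>
    hG.measurable.comp (measurable_rescale _ _)
  set X : ℕ → ℕ → Ω → ℝ := fun n i ω => G (rescale (h n) r (R i ω)) with hX
  have hXm : ∀ n i, Measurable (X n i) := fun n i => (hgm n).comp (hRm i)
  have hXid : ∀ n i, IdentDistrib (X n i) (X n 0) μ μ := fun n i => (hid i).comp (hgm n)
  have hXLp : ∀ n i, MemLp (X n i) 2 μ := fun n i =>
    MemLp.of_bound (hXm n i).aestronglyMeasurable C (ae_of_all _ fun ω => hb _)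
  have hXind : ∀ n, iIndepFun (X n) μ := fun n => hind.comp (fun _ x => G (rescale (h n) r x))
    fun _ => hgm n
  have hsumLp : ∀ n, MemLp (fun ω => ∑ i ∈ Finset.range n, X n i ω) 2 μ := fun n =>
    memLp_finsetSum _ fun i _ => hXLp n i
  have hALp : ∀ n, MemLp (localAvg G h r R n) 2 μ := fun n => (hsumLp n).const_mul _
  have hint : ∀ n i, Integrable (X n i) μ := fun n i => (hXLp n i).integrable (by norm_num)
  have hmean : Tendsto (fun n => ∫ ω, localAvg G h r R n ω ∂μ) atTop (𝓝 (f r * ∫ z, G z)) := by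
    have hsm := tendsto_integral_rescale hf hpos h0 hG (F := fun _ => 1) measurable_const
      continuousAt_const
    simp only [mul_one] at hsm
    refine hsm.congr' ?_
    filter_upwards [eventually_ge_atTop 1] with n hn
    have hn0 : (n : ℝ) ≠ 0 := by positivity
    rw [integral_map (hRm 0).aemeasurable (hgm n).aestronglyMeasurable]
    simp only [localAvg]
    rw [integral_const_mul, integral_finsetSum _ fun i _ => hint n i,
      Finset.sum_congr rfl fun i _ => (hXid n i).integral_eq, Finset.sum_const, Finset.card_range,
      nsmul_eq_mul, effSize, mul_inv, hX]
    field_simp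
  have hvar : Tendsto (fun n => Var[localAvg G h r R n; μ]) atTop (𝓝 0) := by
    have hsm := tendsto_integral_rescale hf hpos h0 hG.sq (F := fun _ => 1) measurable_const
      continuousAt_const
    simp only [mul_one] at hsm
    have hlim := ha.inv_tendsto_atTop.mul hsm
    rw [zero_mul] at hlim
    refine tendsto_of_tendsto_of_tendsto_of_le_of_le' tendsto_const_nhds hlim
      (Eventually.of_forall fun n => variance_nonneg _ _) ?_
    filter_upwards [eventually_ge_atTop 1] with n hn
    have hn0 : (n : ℝ) ≠ 0 := by positivity
    have hh : 0 < ∏ k, h n k := Finset.prod_pos fun k _ => hpos n k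
    have hsum : Var[fun ω => ∑ i ∈ Finset.range n, X n i ω; μ] = n * Var[X n 0; μ] := by
      have := IndepFun.variance_sum (s := Finset.range n) (fun i _ => hXLp n i)
        fun i _ j _ hij => (hXind n).indepFun hij
      rw [Finset.sum_congr rfl fun i _ => (hXid n i).variance_eq, Finset.sum_const,
        Finset.card_range, nsmul_eq_mul] at this
      rw [← this]
      congr 1
      ext ω
      simp
    have hle : Var[X n 0; μ] ≤ ∫ x, G (rescale (h n) r x) ^ 2 ∂(μ.map (R 0)) := by
      rw [integral_map (hRm 0).aemeasurable ((hgm n).pow_const 2).aestronglyMeasurable]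
      exact variance_le_expectation_sq (hXm n 0).aestronglyMeasurable
    have : Var[localAvg G h r R n; μ] = (effSize h n)⁻¹ ^ 2 * (n * Var[X n 0; μ]) := by
      rw [← hsum, ← variance_const_mul]
      rfl
    rw [this]
    have he : 0 < effSize h n := mul_pos (by positivity) hh
    calc (effSize h n)⁻¹ ^ 2 * (n * Var[X n 0; μ])
        = (effSize h n)⁻¹ * ((∏ k, h n k)⁻¹ * Var[X n 0; μ]) := by
          rw [effSize]; field_simp
      _ ≤ _ := by
          simp only [Pi.inv_apply]
          gcongr
  rw [tendstoInMeasure_iff_norm]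
  intro e he
  have hclose : ∀ᶠ n in atTop, |∫ ω, localAvg G h r R n ω ∂μ - f r * ∫ z, G z| < e / 2 := by
    have := (Metric.tendsto_nhds.1 hmean) (e / 2) (by positivity)
    simpa [Real.dist_eq] using this
  have hlim : Tendsto (fun n => ENNReal.ofReal (Var[localAvg G h r R n; μ] / (e / 2) ^ 2)) atTop
      (𝓝 0) := by
    have := ENNReal.tendsto_ofReal (hvar.div_const ((e / 2) ^ 2))
    simpa using this
  refine tendsto_of_tendsto_of_tendsto_of_le_of_le' tendsto_const_nhds hlim
    (Eventually.of_forall fun _ => zero_le) ?_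
  filter_upwards [hclose] with n hn
  refine (measure_mono fun ω hω => ?_).trans (meas_ge_le_variance_div_sq (hALp n) (half_pos he))
  simp only [Set.mem_ofPred_eq, Real.norm_eq_abs] at hω ⊢
  have := abs_sub_le (localAvg G h r R n ω) (∫ ω, localAvg G h r R n ω ∂μ) (f r * ∫ z, G z)
  linarith

end LocalAverage

end LocalPoly

namespace LocalPoly

/-! ### A central limit theorem for row-wise i.i.d. arrays -/

section TriangularArray

/-- Second-order expansion of `exp (i x)` with an error that a moment of order `2 + δ` controls. -/
lemma norm_cexp_sub_taylor_two_le (x : ℝ) {δ : ℝ} (hδ : 0 < δ) (hδ1 : δ ≤ 1) :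
    ‖Complex.exp (x * Complex.I) - (1 + x * Complex.I - (x : ℂ) ^ 2 / 2)‖
      ≤ 4 * |x| ^ (2 + δ) := by
  have hnorm : ‖(x : ℂ) * Complex.I‖ = |x| := by simp
  rcases le_or_gt |x| 1 with hx | hx
  · have h := Complex.exp_bound (x := (x : ℂ) * Complex.I) (by rwa [hnorm]) (n := 3) (by norm_num)
    have hsum : ∑ k ∈ Finset.range 3, ((x : ℂ) * Complex.I) ^ k / (k.factorial : ℂ)
        = 1 + x * Complex.I - (x : ℂ) ^ 2 / 2 := by
      simp [Finset.sum_range_succ, mul_pow]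
      ring
    rw [hsum, hnorm] at h
    refine h.trans ?_
    have h3 : |x| ^ 3 ≤ |x| ^ (2 + δ) := by
      rcases (abs_nonneg x).eq_or_lt with h0 | h0
      · rw [← h0, Real.zero_rpow (by positivity)]; norm_num
      · rw [← Real.rpow_natCast]
        exact Real.rpow_le_rpow_of_exponent_ge h0 hx (by push_cast; linarith)
    have h4 : (0 : ℝ) ≤ |x| ^ (2 + δ) := by positivity
    norm_num [Nat.factorial]
    nlinarith
  · have h1 : ‖Complex.exp (x * Complex.I) - (1 + x * Complex.I - (x : ℂ) ^ 2 / 2)‖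
        ≤ 1 + (1 + |x| + |x| ^ 2 / 2) := by
      refine (norm_sub_le _ _).trans (add_le_add (Complex.norm_exp_ofReal_mul_I x).le ?_)
      refine (norm_sub_le _ _).trans (add_le_add ((norm_add_le _ _).trans ?_) ?_)
      · simp
      · simp
    have h2 : |x| ^ 2 ≤ |x| ^ (2 + δ) := by
      rw [← Real.rpow_natCast]
      exact Real.rpow_le_rpow_of_exponent_le hx.le (by push_cast; linarith)
    nlinarith

lemma rpow_two_le_one_add {δ : ℝ} (hδ : 0 < δ) (x : ℝ) : x ^ 2 ≤ 1 + |x| ^ (2 + δ) := by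
  have h0 : (0 : ℝ) ≤ |x| ^ (2 + δ) := by positivity
  rcases le_or_gt |x| 1 with hx | hx
  · rw [← sq_abs]
    nlinarith [abs_nonneg x]
  · have : |x| ^ 2 ≤ |x| ^ (2 + δ) := by
      rw [← Real.rpow_natCast]
      exact Real.rpow_le_rpow_of_exponent_le hx.le (by push_cast; linarith)
    rw [← sq_abs]; linarith

lemma abs_le_one_add_rpow {δ : ℝ} (hδ : 0 < δ) (x : ℝ) : |x| ≤ 1 + |x| ^ (2 + δ) := by
  have h0 : (0 : ℝ) ≤ |x| ^ (2 + δ) := by positivity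
  rcases le_or_gt |x| 1 with hx | hx
  · linarith
  · have : |x| ^ (1 : ℝ) ≤ |x| ^ (2 + δ) :=
      Real.rpow_le_rpow_of_exponent_le hx.le (by linarith)
    rw [Real.rpow_one] at this; linarith

variable {Ω : Type*} [MeasurableSpace Ω] {μ : Measure Ω} [IsProbabilityMeasure μ]

/-- **Lyapunov's theorem** for arrays with independent, identically distributed entries in each
row, in terms of characteristic functions. -/
lemma tendsto_charFun_sum_of_lyapunov {X : ℕ → ℕ → Ω → ℝ} {δ s : ℝ}
    (hm : ∀ n i, Measurable (X n i)) (hind : ∀ n, iIndepFun (X n) μ)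
    (hid : ∀ n i, IdentDistrib (X n i) (X n 0) μ μ) (hδ : 0 < δ) (hδ1 : δ ≤ 1)
    (hint : ∀ᶠ n in atTop, Integrable (fun ω => |X n 0 ω| ^ (2 + δ)) μ)
    (hmean : ∀ᶠ n in atTop, ∫ ω, X n 0 ω ∂μ = 0)
    (hvar : Tendsto (fun n : ℕ => (n : ℝ) * ∫ ω, X n 0 ω ^ 2 ∂μ) atTop (𝓝 s))
    (hlyap : Tendsto (fun n : ℕ => (n : ℝ) * ∫ ω, |X n 0 ω| ^ (2 + δ) ∂μ) atTop (𝓝 0)) :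
    Tendsto (fun n => ∫ ω, Complex.exp ((∑ i ∈ Finset.range n, X n i ω : ℝ) * Complex.I) ∂μ)
      atTop (𝓝 (Complex.exp (-(s : ℂ) / 2))) := by
  set g : ℕ → ℂ := fun n => ∫ ω, Complex.exp (X n 0 ω * Complex.I) ∂μ - 1 with hg
  have hprod : ∀ n, ∫ ω, Complex.exp ((∑ i ∈ Finset.range n, X n i ω : ℝ) * Complex.I) ∂μ
      = (1 + g n) ^ n := by
    intro n
    have h1 := iIndepFun.charFun_map_fun_finsetSum_eq_prod (s := Finset.range n)
      (fun i _ => (hm n i).aemeasurable) ((hind n).restrict _)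
    have h2 := congrFun h1 1
    have hc : ∀ Z : Ω → ℝ, Measurable Z →
        charFun (μ.map Z) 1 = ∫ ω, Complex.exp (Z ω * Complex.I) ∂μ := by
      intro Z hZ
      rw [charFun_apply_real, integral_map hZ.aemeasurable (by fun_prop)]
      simp
    rw [hc _ (Finset.measurable_fun_sum _ fun i _ => hm n i), Finset.prod_apply] at h2
    rw [h2, Finset.prod_congr rfl fun i _ => by rw [(hid n i).map_eq, hc _ (hm n 0)],
      Finset.prod_const, Finset.card_range]
    simp [hg]
  simp_rw [hprod]
  refine Complex.tendsto_one_add_pow_exp_of_tendsto ?_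
  -- `n g_n` is `-s / 2` up to the Lyapunov sum.
  have hmain : Tendsto (fun n : ℕ => -(((n : ℝ) * ∫ ω, X n 0 ω ^ 2 ∂μ : ℝ) : ℂ) / 2) atTop
      (𝓝 (-(s : ℂ) / 2)) :=
    ((Complex.continuous_ofReal.tendsto s).comp hvar).neg.div_const 2
  have hdiff : Tendsto (fun n : ℕ => (n : ℂ) * g n
      - -(((n : ℝ) * ∫ ω, X n 0 ω ^ 2 ∂μ : ℝ) : ℂ) / 2) atTop (𝓝 0) := by
    have hbd := hlyap.const_mul 4
    rw [mul_zero] at hbd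
    refine squeeze_zero_norm' ?_ hbd
    filter_upwards [hint, hmean] with n hi h0
    have hX1 : Integrable (X n 0) μ :=
      ((integrable_const (1 : ℝ)).add hi).mono' (hm n 0).aestronglyMeasurable
        (ae_of_all _ fun ω => abs_le_one_add_rpow hδ _)
    have hX2 : Integrable (fun ω => X n 0 ω ^ 2) μ :=
      ((integrable_const (1 : ℝ)).add hi).mono' ((hm n 0).pow_const 2).aestronglyMeasurable
        (ae_of_all _ fun ω => by
          rw [Real.norm_of_nonneg (sq_nonneg _)]; exact rpow_two_le_one_add hδ _)
    have hE : Integrable (fun ω => Complex.exp (X n 0 ω * Complex.I)) μ := by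
      refine Integrable.of_bound ?_ 1 (ae_of_all _ fun ω => ?_)
      · have := hm n 0
        exact Measurable.aestronglyMeasurable (by fun_prop)
      · exact (Complex.norm_exp_ofReal_mul_I _).le
    have hX1c : Integrable (fun ω => (X n 0 ω : ℂ) * Complex.I) μ := hX1.ofReal.mul_const _
    have hX2c : Integrable (fun ω => (X n 0 ω : ℂ) ^ 2 / 2) μ := by
      have := (hX2.ofReal (𝕜 := ℂ)).div_const 2
      simpa using this
    have hP : Integrable
        (fun ω => 1 + (X n 0 ω : ℂ) * Complex.I - (X n 0 ω : ℂ) ^ 2 / 2) μ :=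
      ((integrable_const (1 : ℂ)).add hX1c).sub hX2c
    have hPval : ∫ ω, (1 + (X n 0 ω : ℂ) * Complex.I - (X n 0 ω : ℂ) ^ 2 / 2) ∂μ
        = 1 - ((∫ ω, X n 0 ω ^ 2 ∂μ : ℝ) : ℂ) / 2 := by
      have e1 : ∫ ω, (X n 0 ω : ℂ) * Complex.I ∂μ = 0 := by
        rw [integral_mul_const, integral_complex_ofReal, h0]; simp
      have e2 : ∫ ω, (X n 0 ω : ℂ) ^ 2 / 2 ∂μ = ((∫ ω, X n 0 ω ^ 2 ∂μ : ℝ) : ℂ) / 2 := by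
        rw [integral_div, ← integral_complex_ofReal]
        simp
      have hP1 : Integrable (fun ω => 1 + (X n 0 ω : ℂ) * Complex.I) μ :=
        (integrable_const (1 : ℂ)).add hX1c
      rw [integral_sub hP1 hX2c, integral_add (integrable_const (1 : ℂ)) hX1c, e1, e2]
      simp
    have hrw : (n : ℂ) * g n - -(((n : ℝ) * ∫ ω, X n 0 ω ^ 2 ∂μ : ℝ) : ℂ) / 2
        = (n : ℂ) * ∫ ω, (Complex.exp (X n 0 ω * Complex.I)
            - (1 + (X n 0 ω : ℂ) * Complex.I - (X n 0 ω : ℂ) ^ 2 / 2)) ∂μ := by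
      rw [integral_sub hE hP, hPval, hg]
      push_cast
      ring
    rw [hrw, norm_mul, Complex.norm_natCast]
    calc (n : ℝ) * ‖∫ ω, (Complex.exp (X n 0 ω * Complex.I)
            - (1 + (X n 0 ω : ℂ) * Complex.I - (X n 0 ω : ℂ) ^ 2 / 2)) ∂μ‖
        ≤ n * ∫ ω, 4 * |X n 0 ω| ^ (2 + δ) ∂μ := by
          gcongr
          exact norm_integral_le_of_norm_le (hi.const_mul 4)
            (ae_of_all _ fun ω => norm_cexp_sub_taylor_two_le _ hδ hδ1)
      _ = _ := by rw [integral_const_mul]; ring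
  simpa using hdiff.add hmain

end TriangularArray

/-! ### Conditional moments of the errors -/

section ConditionalMoments

variable {d : ℕ} {ν : Measure (Fin d → ℝ)}
  {κ : Kernel (Fin d → ℝ) ℝ}

/-- A moment bound of some order above two gives one of order in `(2, 3]`. -/
lemma exists_moment_le_one [IsMarkovKernel κ] {p : ℕ} {m : (Fin d → ℝ) → ℝ} {r : Fin d → ℝ}
    (hs : SmoothnessAssumption p m κ r) :
    ∃ δ : ℝ, 0 < δ ∧ δ ≤ 1 ∧ ∃ C : ℝ, 0 ≤ C ∧ ∃ U ∈ 𝓝 r, ∀ z ∈ U,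
      ∫⁻ e, ENNReal.ofReal (|e| ^ (2 + δ)) ∂(κ z) ≤ ENNReal.ofReal C := by
  obtain ⟨δ, hδ, C, U, hU, hC⟩ := hs.moment
  refine ⟨min δ 1, lt_min hδ one_pos, min_le_right _ _, 1 + |C|, by positivity, U, hU,
    fun z hz => ?_⟩
  have hle : ∀ e : ℝ, |e| ^ (2 + min δ 1) ≤ 1 + |e| ^ (2 + δ) := by
    intro e
    have h0 : (0 : ℝ) ≤ |e| ^ (2 + δ) := by positivity
    have hmin : 0 < min δ 1 := lt_min hδ one_pos
    rcases le_or_gt |e| 1 with he | he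
    · have := Real.rpow_le_one (abs_nonneg e) he (z := 2 + min δ 1) (by positivity)
      linarith
    · have : |e| ^ (2 + min δ 1) ≤ |e| ^ (2 + δ) :=
        Real.rpow_le_rpow_of_exponent_le he.le (by linarith [min_le_left δ 1])
      linarith
  calc ∫⁻ e, ENNReal.ofReal (|e| ^ (2 + min δ 1)) ∂(κ z)
      ≤ ∫⁻ e, (1 + ENNReal.ofReal (|e| ^ (2 + δ))) ∂(κ z) := by
        refine lintegral_mono fun e => ?_
        rw [← ENNReal.ofReal_one, ← ENNReal.ofReal_add zero_le_one (by positivity)]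
        exact ENNReal.ofReal_le_ofReal (hle e)
    _ ≤ 1 + ENNReal.ofReal |C| := by
        rw [lintegral_add_left measurable_const]
        simp only [lintegral_const, measure_univ, mul_one]
        gcongr
        exact (hC z hz).trans (ENNReal.ofReal_le_ofReal (le_abs_self C))
    _ = _ := by rw [ENNReal.ofReal_add zero_le_one (abs_nonneg C), ENNReal.ofReal_one]

/-- A bounded weight that vanishes where the moment bound fails makes functions of the error
integrable. -/
lemma integrable_weight_mul [IsProbabilityMeasure ν] [IsMarkovKernel κ] {W : (Fin d → ℝ) → ℝ} (hW : Measurable W) {B : ℝ}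
    (hB : ∀ x, |W x| ≤ B) {U : Set (Fin d → ℝ)} (hWU : ∀ x, W x ≠ 0 → x ∈ U) {s C : ℝ}
    (hC : ∀ z ∈ U, ∫⁻ e, ENNReal.ofReal (|e| ^ s) ∂(κ z) ≤ ENNReal.ofReal C)
    {g : ℝ → ℝ} (hg : Measurable g) (hgs : ∀ e, |g e| ≤ 1 + |e| ^ s) :
    Integrable (fun q : (Fin d → ℝ) × ℝ => W q.1 * g q.2) (ν ⊗ₘ κ) := by
  have hmeas : Measurable fun q : (Fin d → ℝ) × ℝ => W q.1 * g q.2 :=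
    (hW.comp measurable_fst).mul (hg.comp measurable_snd)
  refine ⟨hmeas.aestronglyMeasurable, ?_⟩
  rw [HasFiniteIntegral, Measure.lintegral_compProd hmeas.enorm]
  have hle : ∀ x, ∫⁻ e, ‖W x * g e‖ₑ ∂(κ x) ≤ ENNReal.ofReal B * (1 + ENNReal.ofReal C) := by
    intro x
    by_cases hx : W x = 0
    · simp [hx]
    simp_rw [enorm_mul]
    rw [lintegral_const_mul _ hg.enorm]
    gcongr
    · rw [Real.enorm_eq_ofReal_abs]
      exact ENNReal.ofReal_le_ofReal (hB x)
    · calc ∫⁻ e, ‖g e‖ₑ ∂(κ x) ≤ ∫⁻ e, (1 + ENNReal.ofReal (|e| ^ s)) ∂(κ x) := by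
            refine lintegral_mono fun e => ?_
            rw [Real.enorm_eq_ofReal_abs, ← ENNReal.ofReal_one,
              ← ENNReal.ofReal_add zero_le_one (by positivity)]
            exact ENNReal.ofReal_le_ofReal (hgs e)
        _ ≤ _ := by
            rw [lintegral_add_left measurable_const]
            simp only [lintegral_const, measure_univ, mul_one]
            gcongr
            exact hC x (hWU x hx)
  refine (lintegral_mono hle).trans_lt ?_
  simp only [lintegral_const, measure_univ, mul_one]
  exact ENNReal.mul_lt_top ENNReal.ofReal_lt_top (by simp)

lemma integral_rpow_le {s C : ℝ} (hC0 : 0 ≤ C) {z : Fin d → ℝ}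
    (hC : ∫⁻ e, ENNReal.ofReal (|e| ^ s) ∂(κ z) ≤ ENNReal.ofReal C) :
    ∫ e, |e| ^ s ∂(κ z) ≤ C := by
  rw [integral_eq_lintegral_of_nonneg_ae (ae_of_all _ fun e => by positivity)
    (Measurable.aestronglyMeasurable (by fun_prop))]
  exact ENNReal.toReal_le_of_le_ofReal hC0 hC

lemma measurable_condVar : Measurable (condVar κ) :=
  (StronglyMeasurable.integral_kernel (κ := κ)
    (f := fun e : ℝ => e ^ 2) (by fun_prop)).measurable

lemma condVar_nonneg (z : Fin d → ℝ) : 0 ≤ condVar κ z :=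
  integral_nonneg fun e => sq_nonneg e

end ConditionalMoments

/-! ### Asymptotic normality of the weighted errors -/

section WeightedErrors

variable {Ω : Type*} [MeasurableSpace Ω] {μ : Measure Ω} {d p : ℕ} {R : ℕ → Ω → Fin d → ℝ} {Y ε : ℕ → Ω → ℝ} {m f : (Fin d → ℝ) → ℝ}
  {κ : Kernel (Fin d → ℝ) ℝ} {r : Fin d → ℝ} {h : ℕ → Fin d → ℝ}

lemma RegressionModel.measurable_error (hmodel : RegressionModel μ R Y ε m κ) (i : ℕ) :
    Measurable (ε i) := by
  have : ε i = fun ω => Y i ω - m (R i ω) := by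
    ext ω; rw [hmodel.model]; ring
  rw [this]
  exact (hmodel.measurable_Y i).sub (hmodel.measurable_m.comp (hmodel.measurable_R i))

lemma RegressionModel.error_eq (hmodel : RegressionModel μ R Y ε m κ) (i : ℕ) (ω : Ω) :
    ε i ω = Y i ω - m (R i ω) := by
  rw [hmodel.model]; ring

/-- The normalized weighted error sum `(n h_1 ⋯ h_d)^{-1/2} ∑_{i < n} G((R_i - r) / h) ε_i`. -/
noncomputable def errorSum {Ω : Type*} {d : ℕ} (G : (Fin d → ℝ) → ℝ) (h : ℕ → Fin d → ℝ)
    (r : Fin d → ℝ) (R : ℕ → Ω → Fin d → ℝ) (ε : ℕ → Ω → ℝ) (n : ℕ) (ω : Ω) : ℝ :=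
  ∑ i ∈ Finset.range n, (Real.sqrt (effSize h n))⁻¹ * (G (rescale (h n) r (R i ω)) * ε i ω)

/-- The weighted errors are asymptotically normal: the conditional moments of the errors turn the
moments of the summands into local averages of the regressors. -/
lemma tendsto_charFun_errorSum [IsProbabilityMeasure μ] [IsMarkovKernel κ]
    (hmodel : RegressionModel μ R Y ε m κ)
    (hf : DensityAssumption (μ.map (R 0)) f r) (hs : SmoothnessAssumption p m κ r)
    (hpos : ∀ n k, 0 < h n k) (h0 : ∀ k, Tendsto (fun n => h n k) atTop (𝓝 0))
    (ha : Tendsto (effSize h) atTop atTop) {G : (Fin d → ℝ) → ℝ} (hG : IsLocalWeight G) :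
    Tendsto (fun n => ∫ ω, Complex.exp ((errorSum G h r R ε n ω : ℝ) * Complex.I) ∂μ) atTop
      (𝓝 (Complex.exp (-((f r * condVar κ r * ∫ z, G z ^ 2 : ℝ) : ℂ) / 2))) := by
  obtain ⟨δ, hδ, hδ1, C, hC0, U, hU, hC⟩ := exists_moment_le_one hs
  obtain ⟨B, hB0, hB⟩ := hG.bounded
  have : IsProbabilityMeasure (μ.map (R 0)) :=
    Measure.isProbabilityMeasure_map (hmodel.measurable_R 0).aemeasurable
  set W : ℕ → (Fin d → ℝ) → ℝ := fun n x => G (rescale (h n) r x) with hWdef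
  have hW : ∀ n, Measurable (W n) := fun n => hG.measurable.comp (measurable_rescale _ _)
  have hWU : ∀ᶠ n in atTop, ∀ x, W n x ≠ 0 → x ∈ U := eventually_support_subset hpos h0 hG hU
  set τ : ℕ → ℝ := fun n => (Real.sqrt (effSize h n))⁻¹ with hτ
  have hτ0 : ∀ n, 0 ≤ τ n := fun n => by positivity
  -- The law of the pair `(R_0, ε_0)`.
  have hjoint : ∀ Φ : (Fin d → ℝ) × ℝ → ℝ, Measurable Φ →
      ∫ ω, Φ (R 0 ω, ε 0 ω) ∂μ = ∫ q, Φ q ∂((μ.map (R 0)) ⊗ₘ κ) := by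
    intro Φ hΦ
    rw [← hmodel.condDistrib.map_eq, integral_map hmodel.condDistrib.aemeasurable
      hΦ.aestronglyMeasurable]
  have hjoint_int : ∀ Φ : (Fin d → ℝ) × ℝ → ℝ, Measurable Φ →
      Integrable Φ ((μ.map (R 0)) ⊗ₘ κ) → Integrable (fun ω => Φ (R 0 ω, ε 0 ω)) μ := by
    intro Φ hΦ hi
    rw [← hmodel.condDistrib.map_eq] at hi
    exact hi.comp_aemeasurable hmodel.condDistrib.aemeasurable
  have hcm : ∀ (w : (Fin d → ℝ) → ℝ) (g : ℝ → ℝ), Measurable w → Measurable g →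
      Measurable fun q : (Fin d → ℝ) × ℝ => w q.1 * g q.2 := fun w g hw hg =>
    (hw.comp measurable_fst).mul (hg.comp measurable_snd)
  -- Conditional moments of orders `1`, `2` and `2 + δ`.
  have hmom : ∀ (w : (Fin d → ℝ) → ℝ) (g : ℝ → ℝ), Measurable w → Measurable g →
      Integrable (fun q : (Fin d → ℝ) × ℝ => w q.1 * g q.2) ((μ.map (R 0)) ⊗ₘ κ) →
      ∫ ω, w (R 0 ω) * g (ε 0 ω) ∂μ = ∫ x, w x * ∫ e, g e ∂(κ x) ∂(μ.map (R 0)) := by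
    intro w g hw hg hi
    rw [hjoint _ (hcm w g hw hg), Measure.integral_compProd hi]
    simp_rw [integral_const_mul]
  have hrm : Measurable fun e : ℝ => |e| ^ (2 + δ) := by fun_prop
  have hsplit : ∀ n ω, |τ n * (W n (R 0 ω) * ε 0 ω)| ^ (2 + δ)
      = τ n ^ (2 + δ) * (|W n (R 0 ω)| ^ (2 + δ) * |ε 0 ω| ^ (2 + δ)) := by
    intro n ω
    rw [abs_mul, abs_mul, abs_of_nonneg (hτ0 n), Real.mul_rpow (hτ0 n) (by positivity),
      Real.mul_rpow (abs_nonneg _) (abs_nonneg _)]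
  have hGδ : IsLocalWeight fun z => |G z| ^ (2 + δ) :=
    hG.comp_continuous (g := fun t => |t| ^ (2 + δ))
      (continuous_abs.rpow_const fun _ => Or.inr (by positivity))
      (by simp only [abs_zero]; exact Real.zero_rpow (by positivity))
  obtain ⟨Bδ, hBδ0, hBδ⟩ := hGδ.bounded
  have hWδm : ∀ n, Measurable fun x => |W n x| ^ (2 + δ) := fun n =>
    hGδ.measurable.comp (measurable_rescale (h n) r)
  have hintδ : ∀ᶠ n in atTop, Integrable
      (fun q : (Fin d → ℝ) × ℝ => |W n q.1| ^ (2 + δ) * |q.2| ^ (2 + δ))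
      ((μ.map (R 0)) ⊗ₘ κ) := by
    filter_upwards [hWU] with n hn
    refine integrable_weight_mul (W := fun x => |W n x| ^ (2 + δ)) (hWδm n) (fun x => hBδ _)
      (fun x hx => hn x fun h => hx ?_) hC hrm fun e => ?_
    · rw [h, abs_zero]; exact Real.zero_rpow (by positivity)
    · rw [abs_of_nonneg (by positivity)]; linarith
  refine tendsto_charFun_sum_of_lyapunov
    (X := fun n i ω => τ n * (W n (R i ω) * ε i ω)) (fun n i => ?_) (fun n => ?_) (fun n i => ?_)
    hδ hδ1 ?_ ?_ ?_ ?_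
  · exact (((hW n).comp (hmodel.measurable_R i)).mul (hmodel.measurable_error i)).const_mul _
  · have := hmodel.indep.comp (fun _ q => τ n * (W n q.1 * (q.2 - m q.1))) fun _ =>
      (((hW n).comp measurable_fst).mul
        (measurable_snd.sub (hmodel.measurable_m.comp measurable_fst))).const_mul _
    simp only [hmodel.error_eq]
    exact this
  · have := (hmodel.identDistrib i).comp (u := fun q => τ n * (W n q.1 * (q.2 - m q.1)))
      ((((hW n).comp measurable_fst).mul
        (measurable_snd.sub (hmodel.measurable_m.comp measurable_fst))).const_mul _)
    simp only [hmodel.error_eq]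
    exact this
  · filter_upwards [hintδ] with n hn
    simp_rw [hsplit]
    exact (hjoint_int _ (hcm _ _ (hWδm n) hrm) hn).const_mul _
  · filter_upwards [hWU] with n hn
    rw [integral_const_mul, hmom (W n) (fun e => e) (hW n) measurable_id
      (integrable_weight_mul (hW n) (fun x => hB _) hn hC measurable_id
        fun e => abs_le_one_add_rpow hδ e)]
    have : ∫ x, W n x * ∫ e, e ∂(κ x) ∂(μ.map (R 0)) = ∫ _, (0 : ℝ) ∂(μ.map (R 0)) := by
      refine integral_congr_ae ?_
      filter_upwards [hmodel.condMean] with x hx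
      rw [hx.2, mul_zero]
    rw [this, integral_zero, mul_zero]
  · have hsm := tendsto_integral_rescale hf hpos h0 hG.sq measurable_condVar hs.variance
    refine hsm.congr' ?_
    filter_upwards [hWU, eventually_ge_atTop 1] with n hn hn1
    have hn0 : (n : ℝ) ≠ 0 := by positivity
    have hh : 0 < ∏ k, h n k := Finset.prod_pos fun k _ => hpos n k
    have he : 0 ≤ effSize h n := mul_nonneg (Nat.cast_nonneg n) hh.le
    have hsq : ∀ ω, (τ n * (W n (R 0 ω) * ε 0 ω)) ^ 2
        = (effSize h n)⁻¹ * (W n (R 0 ω) ^ 2 * ε 0 ω ^ 2) := by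
      intro ω
      rw [mul_pow, mul_pow, hτ, inv_pow, Real.sq_sqrt he]
    simp_rw [hsq]
    rw [integral_const_mul, hmom (fun x => W n x ^ 2) (fun e => e ^ 2) ((hW n).pow_const 2)
      (measurable_id.pow_const 2) (integrable_weight_mul (B := B ^ 2) ((hW n).pow_const 2) (fun x => ?_)
        (fun x hx => hn x fun h => hx (by rw [h]; norm_num)) hC
        (measurable_id.pow_const 2) fun e => ?_)]
    · rw [effSize, mul_inv]
      have : ∀ x, ∫ e, e ^ 2 ∂(κ x) = condVar κ x := fun _ => rfl
      simp_rw [this]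
      field_simp
      rfl
    · rw [abs_pow]
      exact pow_le_pow_left₀ (abs_nonneg _) (hB _) 2
    · rw [id, abs_of_nonneg (sq_nonneg e)]
      exact rpow_two_le_one_add hδ e
  · -- The Lyapunov sum is of order `(n h_1 ⋯ h_d)^{-δ/2}`.
    have hsm := tendsto_integral_rescale hf hpos h0 hGδ (F := fun _ => 1) measurable_const
      continuousAt_const
    simp only [mul_one] at hsm
    have hdecay : Tendsto (fun n => effSize h n ^ (-(δ / 2))) atTop (𝓝 0) :=
      (tendsto_rpow_neg_atTop (by positivity)).comp ha
    have hlim := hdecay.mul (hsm.const_mul C)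
    rw [zero_mul] at hlim
    refine tendsto_of_tendsto_of_tendsto_of_le_of_le' tendsto_const_nhds hlim
      (Eventually.of_forall fun n => mul_nonneg (Nat.cast_nonneg n)
        (integral_nonneg fun ω => by positivity)) ?_
    filter_upwards [hWU, hintδ, eventually_ge_atTop 1] with n hn hi hn1
    have hn0 : (n : ℝ) ≠ 0 := by positivity
    have hh : 0 < ∏ k, h n k := Finset.prod_pos fun k _ => hpos n k
    have he : 0 < effSize h n := mul_pos (by positivity) hh
    have hτpow : τ n ^ (2 + δ) = (effSize h n)⁻¹ * effSize h n ^ (-(δ / 2)) := by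
      simp only [hτ]
      rw [Real.sqrt_eq_rpow, ← Real.rpow_neg he.le, ← Real.rpow_mul he.le,
        ← Real.rpow_neg_one, ← Real.rpow_add he]
      congr 1; ring
    simp_rw [hsplit]
    rw [integral_const_mul, hmom (fun x => |W n x| ^ (2 + δ)) (fun e => |e| ^ (2 + δ)) (hWδm n)
      hrm hi, hτpow]
    have hWint : Integrable (fun x => |W n x| ^ (2 + δ)) (μ.map (R 0)) :=
      Integrable.of_bound (hWδm n).aestronglyMeasurable Bδ (ae_of_all _ fun x => hBδ _)
    have hle : ∫ x, |W n x| ^ (2 + δ) * ∫ e, |e| ^ (2 + δ) ∂(κ x) ∂(μ.map (R 0))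
        ≤ C * ∫ x, |W n x| ^ (2 + δ) ∂(μ.map (R 0)) := by
      rw [← integral_const_mul]
      refine integral_mono_of_nonneg (ae_of_all _ fun x => ?_) (hWint.const_mul C)
        (ae_of_all _ fun x => ?_)
      · exact mul_nonneg (by positivity) (integral_nonneg fun e => by positivity)
      · by_cases hx : W n x = 0
        · have hz : (0 : ℝ) ^ (2 + δ) = 0 := Real.zero_rpow (by positivity)
          simp [hx, hz]
        · simp only
          rw [mul_comm C]
          gcongr
          exact integral_rpow_le hC0 (hC x (hn x hx))
    calc (n : ℝ) * ((effSize h n)⁻¹ * effSize h n ^ (-(δ / 2)) *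
          ∫ x, |W n x| ^ (2 + δ) * ∫ e, |e| ^ (2 + δ) ∂(κ x) ∂(μ.map (R 0)))
        ≤ (n : ℝ) * ((effSize h n)⁻¹ * effSize h n ^ (-(δ / 2)) *
          (C * ∫ x, |W n x| ^ (2 + δ) ∂(μ.map (R 0)))) := by gcongr
      _ = effSize h n ^ (-(δ / 2)) * (C * ((∏ k, h n k)⁻¹ *
          ∫ x, |W n x| ^ (2 + δ) ∂(μ.map (R 0)))) := by
          have : (n : ℝ) * (effSize h n)⁻¹ = (∏ k, h n k)⁻¹ := by
            rw [effSize, mul_inv]; field_simp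
          rw [← this]; ring

end WeightedErrors

end LocalPoly

namespace LocalPoly

/-! ### Bandwidths -/

section Bandwidth

variable {d p : ℕ} {h : ℕ → Fin d → ℝ}

lemma BandwidthAssumption.tendsto_effSize (hb : BandwidthAssumption p h) (hd : 0 < d) :
    Tendsto (effSize h) atTop atTop := by
  set j : MonoTuple d p := ⟨fun _ => ⟨0, hd⟩, monotone_const⟩
  refine tendsto_atTop_mono' _ ?_ (hb.tendsto_atTop j)
  filter_upwards [(hb.tendsto_zero ⟨0, hd⟩).eventually_le_const one_pos] with n hn
  have hh : 0 < ∏ k, h n k := Finset.prod_pos fun k _ => hb.pos n k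
  refine mul_le_of_le_one_right (by positivity) (Finset.prod_le_one (fun _ _ => sq_nonneg _) ?_)
  intro ℓ _
  exact pow_le_one₀ (hb.pos n _).le hn

/-- The scaled bandwidth monomials of order `p + 1` stay bounded, indeed converge. -/
lemma BandwidthAssumption.exists_tendsto_sqrt_mul_monom (hb : BandwidthAssumption p h)
    (j : MonoTuple d (p + 1)) :
    ∃ c : ℝ, Tendsto (fun n => Real.sqrt (effSize h n) * monom j.1 (h n)) atTop (𝓝 c) := by
  obtain ⟨c, -, hc⟩ := hb.tendsto_const j
  refine ⟨Real.sqrt c, (hc.sqrt).congr fun n => ?_⟩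
  have hm : 0 ≤ monom j.1 (h n) := Finset.prod_nonneg fun ℓ _ => (hb.pos n _).le
  have hh : 0 < ∏ k, h n k := Finset.prod_pos fun k _ => hb.pos n k
  rw [Finset.prod_pow, Real.sqrt_mul (by positivity)]
  change _ * Real.sqrt (monom j.1 (h n) ^ 2) = _
  rw [Real.sqrt_sq hm]
  rfl

/-- The scaled power `√(n h_1 ⋯ h_d) (max_k h_k)^{p+1}` is eventually bounded. -/
lemma BandwidthAssumption.exists_sqrt_mul_norm_pow_le (hb : BandwidthAssumption p h) :
    ∃ L : ℝ, 0 < L ∧ ∀ᶠ n in atTop, Real.sqrt (effSize h n) * ‖h n‖ ^ (p + 1) ≤ L := by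
  set j : Fin d → MonoTuple d (p + 1) := fun k => ⟨fun _ => k, monotone_const⟩
  choose c hc using fun k => hb.exists_tendsto_sqrt_mul_monom (j k)
  have hsum := tendsto_finsetSum Finset.univ fun k _ => hc k
  refine ⟨|∑ k, c k| + 1, by positivity, ?_⟩
  filter_upwards [hsum.eventually_le_const ((le_abs_self _).trans_lt (lt_add_one _))] with n hn
  refine le_trans ?_ hn
  rw [← Finset.mul_sum]
  refine mul_le_mul_of_nonneg_left ?_ (Real.sqrt_nonneg _)
  have hmon : ∀ k, monom (j k).1 (h n) = h n k ^ (p + 1) := fun k => by simp [monom, j]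
  simp_rw [hmon]
  have h0 : ∀ k ∈ (Finset.univ : Finset (Fin d)), 0 ≤ h n k ^ (p + 1) := fun k _ =>
    pow_nonneg (hb.pos n k).le _
  rcases isEmpty_or_nonempty (Fin d) with hE | hE
  · have : h n = 0 := Subsingleton.elim _ _
    simp [this]
  · obtain ⟨k, hk⟩ := Finite.exists_max fun k => ‖h n k‖
    have : ‖h n‖ ≤ h n k := by
      refine (pi_norm_le_iff_of_nonneg (hb.pos n k).le).2 fun i => (hk i).trans ?_
      rw [Real.norm_of_nonneg (hb.pos n k).le]
    exact (pow_le_pow_left₀ (norm_nonneg _) this _).trans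
      (Finset.single_le_sum h0 (Finset.mem_univ k))

end Bandwidth

lemma monom_sub_eq {d L : ℕ} {h : Fin d → ℝ} (hh : ∀ k, 0 < h k) (j : Fin L → Fin d)
    (r x : Fin d → ℝ) : monom j (x - r) = monom j h * monom j (rescale h r x) := by
  simp only [monom, rescale, ← Finset.prod_mul_distrib]
  refine Finset.prod_congr rfl fun ℓ _ => ?_
  rw [Pi.sub_apply, mul_div_cancel₀ _ (hh _).ne']

lemma monom_pos {d L : ℕ} {h : Fin d → ℝ} (hh : ∀ k, 0 < h k) (j : Fin L → Fin d) :
    0 < monom j h :=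
  Finset.prod_pos fun _ _ => hh _

/-! ### The normal equations -/

/-- The first-order conditions of the weighted least-squares problem. -/
lemma normal_equation {d p : ℕ} {K : (Fin d → ℝ) → ℝ} {h r : Fin d → ℝ} (hh : ∀ k, 0 < h k)
    {n : ℕ} {x : ℕ → Fin d → ℝ} {y : ℕ → ℝ} {β : PolyIdx d p → ℝ}
    (hmin : IsMinOn (criterion p K h r n x y) Set.univ β) (a : PolyIdx d p) :
    ∑ i ∈ Finset.range n, K (rescale h r (x i)) * monom a.2.1 (rescale h r (x i))
      * (y i - ∑ b, β b * monom b.2.1 (x i - r)) = 0 := by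
  classical
  set w : ℕ → ℝ := fun i => K (rescale h r (x i)) with hw
  set e : ℕ → ℝ := fun i => y i - ∑ b, β b * monom b.2.1 (x i - r) with he
  set φ : ℕ → ℝ := fun i => monom a.2.1 (x i - r) with hφ
  have hexp : ∀ s : ℝ, criterion p K h r n x y (β + s • Pi.single a 1)
      = criterion p K h r n x y β + (∑ i ∈ Finset.range n, w i * φ i ^ 2) * (s * s)
        + (-2 * ∑ i ∈ Finset.range n, w i * φ i * e i) * s := by
    intro s
    simp only [criterion]
    rw [Finset.mul_sum, Finset.sum_mul, Finset.sum_mul, ← Finset.sum_add_distrib,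
      ← Finset.sum_add_distrib]
    refine Finset.sum_congr rfl fun i _ => ?_
    have : ∑ b, (β + s • (Pi.single a 1 : PolyIdx d p → ℝ)) b * monom b.2.1 (x i - r)
        = ∑ b, β b * monom b.2.1 (x i - r) + s * φ i := by
      simp only [Pi.add_apply, Pi.smul_apply, smul_eq_mul, add_mul, Finset.sum_add_distrib]
      congr 1
      rw [Finset.sum_eq_single a]
      · simp [hφ]
      · intro b _ hb
        simp [hb]
      · simp
    rw [this]
    simp only [hw, he]
    ring
  have hdisc := discrim_le_zero (a := ∑ i ∈ Finset.range n, w i * φ i ^ 2)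
    (b := -2 * ∑ i ∈ Finset.range n, w i * φ i * e i) (c := 0) fun s => by
      have h1 := isMinOn_iff.1 hmin (β + s • Pi.single a 1) (Set.mem_univ _)
      rw [hexp s] at h1
      linarith
  rw [discrim, mul_zero, sub_zero] at hdisc
  have hzero : ∑ i ∈ Finset.range n, w i * φ i * e i = 0 := by
    have := pow_eq_zero_iff (two_ne_zero) |>.1 (le_antisymm hdisc (sq_nonneg _))
    linarith
  have hφ' : ∀ i, φ i = monom a.2.1 h * monom a.2.1 (rescale h r (x i)) := fun i =>
    monom_sub_eq hh _ _ _
  have hfac : ∑ i ∈ Finset.range n, w i * φ i * e i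
      = monom a.2.1 h * ∑ i ∈ Finset.range n, w i * monom a.2.1 (rescale h r (x i)) * e i := by
    rw [Finset.mul_sum]
    refine Finset.sum_congr rfl fun i _ => ?_
    rw [hφ']; ring
  rw [hfac] at hzero
  exact (mul_eq_zero.1 hzero).resolve_left (monom_pos hh _).ne'

/-! ### Moment matrices of the kernel -/

section Moments

variable {d p : ℕ} {K : (Fin d → ℝ) → ℝ}

lemma KernelAssumption.isLocalWeight (hK : KernelAssumption p K) : IsLocalWeight K := by
  obtain ⟨C, hC⟩ := hK.bounded
  refine ⟨hK.measurable, ⟨C, (hK.nonneg 0).trans (hC 0), fun z => ?_⟩, hK.support⟩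
  rw [abs_of_nonneg (hK.nonneg z)]
  exact hC z

lemma momentMatrix_transpose : (momentMatrix p K).transpose = momentMatrix p K := by
  ext a b
  simp only [momentMatrix, Matrix.transpose_apply, Matrix.of_apply]
  congr 1; ext z; ring

/-- The quadratic form of `𝒦` is the squared norm of a weighted polynomial. -/
lemma dotProduct_sqMomentMatrix_mulVec (hK : KernelAssumption p K) (q : PolyIdx d p → ℝ) :
    q ⬝ᵥ (sqMomentMatrix p K).mulVec q = ∫ z, (K z * ∑ b, q b * monom b.2.1 z) ^ 2 := by
  have hint : ∀ a b : PolyIdx d p, Integrable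
      fun z => q a * (q b * (K z ^ 2 * monom a.2.1 z * monom b.2.1 z)) := fun a b =>
    (((hK.isLocalWeight.sq.mul_continuous (continuous_monom a.2.1)).mul_continuous
      (continuous_monom b.2.1)).integrable.const_mul _).const_mul _
  have hexp : ∀ z, (K z * ∑ b, q b * monom b.2.1 z) ^ 2
      = ∑ a : PolyIdx d p, ∑ b : PolyIdx d p,
        q a * (q b * (K z ^ 2 * monom a.2.1 z * monom b.2.1 z)) := by
    intro z
    rw [mul_pow, sq (∑ b, q b * monom b.2.1 z), Finset.sum_mul_sum, Finset.mul_sum]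
    refine Finset.sum_congr rfl fun a _ => ?_
    rw [Finset.mul_sum]
    refine Finset.sum_congr rfl fun b _ => ?_
    ring
  simp_rw [hexp]
  rw [integral_finsetSum _ fun a _ => integrable_finsetSum _ fun b _ => hint a b]
  simp only [dotProduct, Matrix.mulVec, sqMomentMatrix, Matrix.of_apply]
  refine Finset.sum_congr rfl fun a _ => ?_
  rw [integral_finsetSum _ fun b _ => hint a b, Finset.mul_sum]
  refine Finset.sum_congr rfl fun b _ => ?_
  rw [integral_const_mul, integral_const_mul]
  ring

lemma sqMomentMatrix_posSemidef (hK : KernelAssumption p K) :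
    (sqMomentMatrix p K).PosSemidef := by
  refine Matrix.PosSemidef.of_dotProduct_mulVec_nonneg ?_ fun q => ?_
  · ext a b
    simp only [sqMomentMatrix, Matrix.conjTranspose_apply, Matrix.of_apply, star_trivial]
    congr 1; ext z; ring
  · rw [star_trivial, dotProduct_sqMomentMatrix_mulVec hK]
    exact integral_nonneg fun z => sq_nonneg _

lemma asympCov_posSemidef (hK : KernelAssumption p K) {f : (Fin d → ℝ) → ℝ}
    {κ : Kernel (Fin d → ℝ) ℝ} {r : Fin d → ℝ} (hf : 0 < f r) :
    (asympCov p K f κ r).PosSemidef := by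
  have h1 := (sqMomentMatrix_posSemidef hK).conjTranspose_mul_mul_same (momentMatrix p K)⁻¹
  rw [Matrix.conjTranspose_eq_transpose_of_trivial, Matrix.transpose_nonsing_inv,
    momentMatrix_transpose] at h1
  exact h1.smul (div_nonneg (condVar_nonneg r) hf.le)

end Moments

end LocalPoly

namespace LocalPoly

noncomputable section

/-! ### Decomposition of the estimation error -/

/-- The remainder of the Taylor expansion of `m` at `r` of order `p + 1`. -/
def taylorRem {d : ℕ} (p : ℕ) (m : (Fin d → ℝ) → ℝ) (r x : Fin d → ℝ) : ℝ :=
  m x - ∑ a : PolyIdx d p, derivVec p m r a * monom a.2.1 (x - r)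
    - ∑ b : MonoTuple d (p + 1), partialD b.1 m r / (multFactorial b.1 : ℝ) * monom b.1 (x - r)

section Decomposition

variable {Ω : Type*} {d : ℕ} (p : ℕ) (K m f : (Fin d → ℝ) → ℝ) (h : ℕ → Fin d → ℝ)
  (r : Fin d → ℝ) (R : ℕ → Ω → Fin d → ℝ) (ε : ℕ → Ω → ℝ)

/-- The sample analogue of `f(r) S`. -/
def sampleMoment (n : ℕ) (ω : Ω) : Matrix (PolyIdx d p) (PolyIdx d p) ℝ :=
  Matrix.of fun a b => localAvg (fun z => K z * monom a.2.1 z * monom b.2.1 z) h r R n ω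

/-- The sample analogue of `f(r) B`. -/
def sampleBias (n : ℕ) (ω : Ω) : Matrix (PolyIdx d p) (MonoTuple d (p + 1)) ℝ :=
  Matrix.of fun a b => localAvg (fun z => K z * monom a.2.1 z * monom b.1 z) h r R n ω

/-- The weighted sums of the errors, which carry the limit law. -/
def scoreVec (n : ℕ) (ω : Ω) : PolyIdx d p → ℝ :=
  fun a => errorSum (fun z => K z * monom a.2.1 z) h r R ε n ω

/-- The weighted sums of the Taylor remainders. -/
def remainderVec (n : ℕ) (ω : Ω) : PolyIdx d p → ℝ :=
  fun a => errorSum (fun z => K z * monom a.2.1 z) h r R (fun i ω => taylorRem p m r (R i ω)) n ω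

/-- The asymptotic bias `S⁻¹ B M_n`. -/
def asympBias (n : ℕ) : PolyIdx d p → ℝ :=
  ((momentMatrix p K)⁻¹ * biasMatrix p K).mulVec (biasVec p m r (h n))

/-- The normalized estimation error of a coefficient vector `β`. -/
def scaledError (n : ℕ) (β : PolyIdx d p → ℝ) : PolyIdx d p → ℝ :=
  Real.sqrt (effSize h n) •
    ((bandMatrix p (h n)).mulVec (β - derivVec p m r) - asympBias p K m h r n)

/-- The part of the normal equations that vanishes in probability: sampling fluctuations of the
moment matrices against the scaled bias, and the Taylor remainders. -/
def perturbation (n : ℕ) (ω : Ω) : PolyIdx d p → ℝ :=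
  (sampleBias p K h r R n ω - f r • biasMatrix p K).mulVec
      (Real.sqrt (effSize h n) • biasVec p m r (h n))
    - (sampleMoment p K h r R n ω - f r • momentMatrix p K).mulVec
      (Real.sqrt (effSize h n) • asympBias p K m h r n)
    + remainderVec p K m h r R n ω

variable {p K m f h r R ε}

/-- The normal equations, solved for the rescaled coefficients. -/
lemma sampleMoment_mulVec_bandMatrix (hpos : ∀ n k, 0 < h n k) {Y : ℕ → Ω → ℝ} {n : ℕ} {ω : Ω}
    (hY : ∀ i, Y i ω = m (R i ω) + ε i ω) {β : PolyIdx d p → ℝ}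
    (hmin : IsMinOn (criterion p K (h n) r n (fun i => R i ω) (fun i => Y i ω)) Set.univ β) :
    (sampleMoment p K h r R n ω).mulVec ((bandMatrix p (h n)).mulVec (β - derivVec p m r))
      = (Real.sqrt (effSize h n))⁻¹ • (scoreVec p K h r R ε n ω + remainderVec p K m h r R n ω)
        + (sampleBias p K h r R n ω).mulVec (biasVec p m r (h n)) := by
  ext a
  have heff : 0 ≤ effSize h n :=
    mul_nonneg (Nat.cast_nonneg n) (Finset.prod_nonneg fun k _ => (hpos n k).le)
  set w : ℕ → ℝ := fun i => K (rescale (h n) r (R i ω)) * monom a.2.1 (rescale (h n) r (R i ω))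
    with hw
  have hne := normal_equation (hpos n) hmin a
  have hterm : ∀ i, w i * (Y i ω - ∑ b : PolyIdx d p, β b * monom b.2.1 (R i ω - r))
      = w i * ε i ω + w i * taylorRem p m r (R i ω)
        + ∑ c, w i * monom c.1 (rescale (h n) r (R i ω)) * biasVec p m r (h n) c
        - ∑ b : PolyIdx d p, w i * monom b.2.1 (rescale (h n) r (R i ω))
            * (monom b.2.1 (h n) * (β b - derivVec p m r b)) := by
    intro i
    have e1 : ∑ c, w i * monom c.1 (rescale (h n) r (R i ω)) * biasVec p m r (h n) c
        = w i * ∑ b : MonoTuple d (p + 1),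
          partialD b.1 m r / (multFactorial b.1 : ℝ) * monom b.1 (R i ω - r) := by
      rw [Finset.mul_sum]
      refine Finset.sum_congr rfl fun c _ => ?_
      rw [monom_sub_eq (hpos n), biasVec]; ring
    have e2 : ∑ b : PolyIdx d p, w i * monom b.2.1 (rescale (h n) r (R i ω))
            * (monom b.2.1 (h n) * (β b - derivVec p m r b))
        = w i * ∑ b : PolyIdx d p, β b * monom b.2.1 (R i ω - r)
          - w i * ∑ b : PolyIdx d p, derivVec p m r b * monom b.2.1 (R i ω - r) := by
      rw [Finset.mul_sum, Finset.mul_sum, ← Finset.sum_sub_distrib]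
      refine Finset.sum_congr rfl fun c _ => ?_
      rw [monom_sub_eq (hpos n)]; ring
    rw [e1, e2, hY, taylorRem]
    ring
  have hsum : ∑ i ∈ Finset.range n, ∑ b : PolyIdx d p,
        w i * monom b.2.1 (rescale (h n) r (R i ω)) * (monom b.2.1 (h n) * (β b - derivVec p m r b))
      = ∑ i ∈ Finset.range n, w i * ε i ω + ∑ i ∈ Finset.range n, w i * taylorRem p m r (R i ω)
        + ∑ i ∈ Finset.range n, ∑ c,
          w i * monom c.1 (rescale (h n) r (R i ω)) * biasVec p m r (h n) c := by
    rw [Finset.sum_congr rfl fun i _ => hterm i, Finset.sum_sub_distrib, Finset.sum_add_distrib,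
      Finset.sum_add_distrib] at hne
    linarith
  have hleft : (sampleMoment p K h r R n ω).mulVec
      ((bandMatrix p (h n)).mulVec (β - derivVec p m r)) a
      = (effSize h n)⁻¹ * ∑ i ∈ Finset.range n, ∑ b : PolyIdx d p,
        w i * monom b.2.1 (rescale (h n) r (R i ω))
          * (monom b.2.1 (h n) * (β b - derivVec p m r b)) := by
    rw [Finset.sum_comm, Finset.mul_sum, Matrix.mulVec, dotProduct]
    refine Finset.sum_congr rfl fun b _ => ?_
    rw [bandMatrix, Matrix.mulVec_diagonal, sampleMoment, Matrix.of_apply, localAvg, mul_assoc,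
      ← Finset.sum_mul, Pi.sub_apply]
  have hright : (sampleBias p K h r R n ω).mulVec (biasVec p m r (h n)) a
      = (effSize h n)⁻¹ * ∑ i ∈ Finset.range n, ∑ c,
          w i * monom c.1 (rescale (h n) r (R i ω)) * biasVec p m r (h n) c := by
    rw [Finset.sum_comm, Finset.mul_sum, Matrix.mulVec, dotProduct]
    refine Finset.sum_congr rfl fun b _ => ?_
    rw [sampleBias, Matrix.of_apply, localAvg, mul_assoc, ← Finset.sum_mul]
  have hsq : ∀ u : ℕ → Ω → ℝ, (Real.sqrt (effSize h n))⁻¹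
      * errorSum (fun z => K z * monom a.2.1 z) h r R u n ω
      = (effSize h n)⁻¹ * ∑ i ∈ Finset.range n, w i * u i ω := by
    intro u
    rw [errorSum, ← Finset.mul_sum, ← mul_assoc, ← mul_inv, Real.mul_self_sqrt heff]
  rw [hleft, hsum, Pi.add_apply, hright, Pi.smul_apply, Pi.add_apply, smul_eq_mul,
    mul_add (Real.sqrt (effSize h n))⁻¹, scoreVec, remainderVec, hsq, hsq]
  ring

/-- The normal equations for the normalized estimation error. -/
lemma sampleMoment_mulVec_scaledError (hpos : ∀ n k, 0 < h n k)
    (hS : (momentMatrix p K).det ≠ 0) {Y : ℕ → Ω → ℝ} {n : ℕ} (hn : 1 ≤ n) {ω : Ω}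
    (hY : ∀ i, Y i ω = m (R i ω) + ε i ω) {β : PolyIdx d p → ℝ}
    (hmin : IsMinOn (criterion p K (h n) r n (fun i => R i ω) (fun i => Y i ω)) Set.univ β) :
    (sampleMoment p K h r R n ω).mulVec (scaledError p K m h r n β)
      = scoreVec p K h r R ε n ω + perturbation p K m f h r R n ω := by
  have heff : 0 < effSize h n :=
    mul_pos (by positivity) (Finset.prod_pos fun k _ => hpos n k)
  have hs : Real.sqrt (effSize h n) ≠ 0 := (Real.sqrt_pos.2 heff).ne'
  have hB : (momentMatrix p K).mulVec (asympBias p K m h r n)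
      = (biasMatrix p K).mulVec (biasVec p m r (h n)) := by
    rw [asympBias, Matrix.mulVec_mulVec, ← Matrix.mul_assoc,
      Matrix.mul_nonsing_inv _ (isUnit_iff_ne_zero.2 hS), Matrix.one_mul]
  rw [scaledError, Matrix.mulVec_smul, Matrix.mulVec_sub, sampleMoment_mulVec_bandMatrix hpos hY hmin,
    perturbation, Matrix.sub_mulVec, Matrix.sub_mulVec, Matrix.smul_mulVec, Matrix.smul_mulVec,
    Matrix.mulVec_smul, Matrix.mulVec_smul, Matrix.mulVec_smul, Matrix.mulVec_smul, hB]
  ext a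
  simp only [Pi.smul_apply, Pi.sub_apply, Pi.add_apply, smul_eq_mul]
  field_simp
  ring

end Decomposition

/-! ### The perturbation is negligible -/

section Negligible

variable {Ω : Type*} [MeasurableSpace Ω] {μ : Measure Ω} [IsProbabilityMeasure μ] {d p : ℕ}
  {R : ℕ → Ω → Fin d → ℝ} {m f K : (Fin d → ℝ) → ℝ} {r : Fin d → ℝ} {h : ℕ → Fin d → ℝ}

lemma KernelAssumption.isLocalWeight_mul_monom (hK : KernelAssumption p K) {L : ℕ}
    (j : Fin L → Fin d) : IsLocalWeight fun z => K z * monom j z :=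
  hK.isLocalWeight.mul_continuous (continuous_monom j)

lemma KernelAssumption.isLocalWeight_mul_monom_mul_monom (hK : KernelAssumption p K) {L L' : ℕ}
    (j : Fin L → Fin d) (j' : Fin L' → Fin d) : IsLocalWeight fun z => K z * monom j z * monom j' z :=
  (hK.isLocalWeight_mul_monom j).mul_continuous (continuous_monom j')

/-- On the support of the weights the Taylor remainder is of smaller order than
`(n h_1 ⋯ h_d)^{-1/2}`. -/
lemma eventually_taylorRem_le (hs : ∃ U : Set (Fin d → ℝ), IsOpen U ∧ r ∈ U ∧
      ContDiffOn ℝ ((p + 1 : ℕ) : ℕ∞) m U) (hb : BandwidthAssumption p h)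
    {G : (Fin d → ℝ) → ℝ} (hG : IsLocalWeight G) {η : ℝ} (hη : 0 < η) :
    ∀ᶠ n in atTop, ∀ x, G (rescale (h n) r x) ≠ 0 →
      Real.sqrt (effSize h n) * |taylorRem p m r x| ≤ η := by
  obtain ⟨U, hU, hr, hm⟩ := hs
  obtain ⟨c, hc, hsupp⟩ := hG.eq_zero_of_norm
  obtain ⟨L, hL, hLe⟩ := hb.exists_sqrt_mul_norm_pow_le
  have hη' : 0 < η / (L * c ^ (p + 1)) := by positivity
  obtain ⟨ρ, hρ, hT⟩ := taylor_monom hU hr hm hη'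
  have hh0 : Tendsto (fun n => c * ‖h n‖) atTop (𝓝 0) := by
    have : Tendsto h atTop (𝓝 0) := tendsto_pi_nhds.2 hb.tendsto_zero
    simpa using this.norm.const_mul c
  filter_upwards [hLe, hh0.eventually_lt_const hρ] with n hn hnρ x hx
  have hnorm : ‖x - r‖ ≤ c * ‖h n‖ := by
    refine (pi_norm_le_iff_of_nonneg (by positivity)).2 fun k => ?_
    have h1 : (x - r) k = rescale (h n) r x k * h n k := by
      rw [rescale, div_mul_cancel₀ _ (hb.pos n k).ne', Pi.sub_apply]
    rw [h1, norm_mul]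
    exact mul_le_mul ((norm_le_pi_norm _ k).trans (hsupp _ hx)) (norm_le_pi_norm _ k)
      (norm_nonneg _) hc.le
  have h2 := hT (x - r) (hnorm.trans_lt hnρ)
  rw [add_sub_cancel] at h2
  calc Real.sqrt (effSize h n) * |taylorRem p m r x|
      ≤ Real.sqrt (effSize h n) * (η / (L * c ^ (p + 1)) * (c * ‖h n‖) ^ (p + 1)) := by
        refine mul_le_mul_of_nonneg_left (h2.trans ?_) (Real.sqrt_nonneg _)
        gcongr
    _ = η / L * (Real.sqrt (effSize h n) * ‖h n‖ ^ (p + 1)) := by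
        rw [mul_pow]; field_simp
    _ ≤ η / L * L := by gcongr
    _ = η := by field_simp

lemma tendstoInMeasure_remainderVec
    (hRm : ∀ i, Measurable (R i)) (hind : iIndepFun R μ)
    (hid : ∀ i, IdentDistrib (R i) (R 0) μ μ) (hf : DensityAssumption (μ.map (R 0)) f r)
    (hK : KernelAssumption p K) (hb : BandwidthAssumption p h)
    (ha : Tendsto (effSize h) atTop atTop)
    (hs : ∃ U : Set (Fin d → ℝ), IsOpen U ∧ r ∈ U ∧ ContDiffOn ℝ ((p + 1 : ℕ) : ℕ∞) m U)
    (a : PolyIdx d p) :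
    TendstoInMeasure μ (fun n ω => remainderVec p K m h r R n ω a) atTop (fun _ => (0 : ℝ)) := by
  have hG := hK.isLocalWeight_mul_monom a.2.1
  refine tendstoInMeasure_zero_of_le_small_mul
    (tendstoInMeasure_localAvg hRm hind hid hf hb.pos hb.tendsto_zero ha hG.abs) fun η hη => ?_
  filter_upwards [eventually_taylorRem_le hs hb hG hη, eventually_ge_atTop 1] with n hn hn1 ω
  have heff : 0 < effSize h n :=
    mul_pos (by positivity) (Finset.prod_pos fun k _ => hb.pos n k)
  have hsq : 0 < Real.sqrt (effSize h n) := Real.sqrt_pos.2 heff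
  refine le_trans ?_ (mul_le_mul_of_nonneg_left (le_abs_self _) hη.le)
  rw [remainderVec, errorSum, localAvg, Finset.mul_sum, Finset.mul_sum]
  refine (Finset.abs_sum_le_sum_abs _ _).trans (Finset.sum_le_sum fun i _ => ?_)
  rw [abs_mul, abs_mul, abs_of_pos (inv_pos.2 hsq)]
  set g := K (rescale (h n) r (R i ω)) * monom a.2.1 (rescale (h n) r (R i ω)) with hg
  by_cases hg0 : g = 0
  · simp [hg0]
  have h1 := hn (R i ω) hg0
  have h2 : (effSize h n)⁻¹ = (Real.sqrt (effSize h n))⁻¹ * (Real.sqrt (effSize h n))⁻¹ := by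
    rw [← mul_inv, Real.mul_self_sqrt heff.le]
  have h3 : |taylorRem p m r (R i ω)| ≤ η * (Real.sqrt (effSize h n))⁻¹ := by
    rw [← div_eq_mul_inv, le_div_iff₀ hsq, mul_comm]
    exact h1
  calc (Real.sqrt (effSize h n))⁻¹ * (|g| * |taylorRem p m r (R i ω)|)
      ≤ (Real.sqrt (effSize h n))⁻¹ * (|g| * (η * (Real.sqrt (effSize h n))⁻¹)) := by gcongr
    _ = η * ((effSize h n)⁻¹ * |g|) := by rw [h2]; ring

lemma tendstoInMeasure_perturbation
    (hRm : ∀ i, Measurable (R i)) (hind : iIndepFun R μ)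
    (hid : ∀ i, IdentDistrib (R i) (R 0) μ μ) (hf : DensityAssumption (μ.map (R 0)) f r)
    (hK : KernelAssumption p K) (hb : BandwidthAssumption p h)
    (ha : Tendsto (effSize h) atTop atTop)
    (hs : ∃ U : Set (Fin d → ℝ), IsOpen U ∧ r ∈ U ∧ ContDiffOn ℝ ((p + 1 : ℕ) : ℕ∞) m U)
    (a : PolyIdx d p) :
    TendstoInMeasure μ (fun n ω => perturbation p K m f h r R n ω a) atTop (fun _ => (0 : ℝ)) := by
  have hbias : ∀ c : MonoTuple d (p + 1), ∃ l : ℝ, Tendsto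
      (fun n => (Real.sqrt (effSize h n) • biasVec p m r (h n)) c) atTop (𝓝 l) := by
    intro c
    obtain ⟨l, hl⟩ := hb.exists_tendsto_sqrt_mul_monom c
    refine ⟨_, (hl.const_mul (partialD c.1 m r / (multFactorial c.1 : ℝ))).congr fun n => ?_⟩
    rw [Pi.smul_apply, smul_eq_mul, biasVec]
    ring
  choose l hl using hbias
  have hasymp : ∀ b : PolyIdx d p, ∃ l : ℝ, Tendsto
      (fun n => (Real.sqrt (effSize h n) • asympBias p K m h r n) b) atTop (𝓝 l) := by
    intro b
    refine ⟨_, (tendsto_finsetSum Finset.univ fun c _ =>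
      (hl c).const_mul (((momentMatrix p K)⁻¹ * biasMatrix p K) b c)).congr fun n => ?_⟩
    rw [asympBias, ← Matrix.mulVec_smul]
    rfl
  choose l' hl' using hasymp
  have hlln : ∀ {G : (Fin d → ℝ) → ℝ}, IsLocalWeight G → TendstoInMeasure μ
      (fun n ω => localAvg G h r R n ω - f r * ∫ z, G z) atTop (fun _ => (0 : ℝ)) := fun hG =>
    tendstoInMeasure_sub_const
      (tendstoInMeasure_localAvg hRm hind hid hf hb.pos hb.tendsto_zero ha hG)
  have h1 := tendstoInMeasure_zero_sum Finset.univ fun c _ => tendstoInMeasure_zero_mul (hl c)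
    (hlln (hK.isLocalWeight_mul_monom_mul_monom a.2.1 c.1))
  have h2 := tendstoInMeasure_zero_sum Finset.univ fun b _ => tendstoInMeasure_zero_mul (hl' b).neg
    (hlln (hK.isLocalWeight_mul_monom_mul_monom a.2.1 b.2.1))
  refine (tendstoInMeasure_zero_add (tendstoInMeasure_zero_add h1 h2)
    (tendstoInMeasure_remainderVec hRm hind hid hf hK hb ha hs a)).congr_left fun n =>
      ae_of_all _ fun ω => ?_
  simp only [mul_neg, Finset.sum_neg_distrib]
  rfl

end Negligible

end

end LocalPoly

namespace LocalPoly

noncomputable section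

/-! ### Passage to the limit -/

section Limit

variable {Ω : Type*} [MeasurableSpace Ω] {μ : Measure Ω} {d p : ℕ}
  {R : ℕ → Ω → Fin d → ℝ} {Y ε : ℕ → Ω → ℝ} {m f K : (Fin d → ℝ) → ℝ}
  {κ : Kernel (Fin d → ℝ) ℝ} {r : Fin d → ℝ} {h : ℕ → Fin d → ℝ}

/-- `(f(r) S)⁻¹` applied to the weighted errors. -/
def linearTerm (p : ℕ) (K f : (Fin d → ℝ) → ℝ) (h : ℕ → Fin d → ℝ) (r : Fin d → ℝ)
    (R : ℕ → Ω → Fin d → ℝ) (ε : ℕ → Ω → ℝ) (n : ℕ) (ω : Ω) : PolyIdx d p → ℝ :=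
  ((f r)⁻¹ • (momentMatrix p K)⁻¹).mulVec (scoreVec p K h r R ε n ω)

lemma measurable_errorSum (hRm : ∀ i, Measurable (R i)) {u : ℕ → Ω → ℝ}
    (hu : ∀ i, Measurable (u i)) {G : (Fin d → ℝ) → ℝ} (hG : Measurable G) (n : ℕ) :
    Measurable (errorSum G h r R u n) :=
  Finset.measurable_fun_sum _ fun i _ =>
    ((hG.comp ((measurable_rescale _ _).comp (hRm i))).mul (hu i)).const_mul _

lemma measurable_localAvg (hRm : ∀ i, Measurable (R i)) {G : (Fin d → ℝ) → ℝ}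
    (hG : Measurable G) (n : ℕ) : Measurable (localAvg G h r R n) :=
  (Finset.measurable_fun_sum _ fun i _ =>
    hG.comp ((measurable_rescale _ _).comp (hRm i))).const_mul _

lemma measurable_sampleMoment (hRm : ∀ i, Measurable (R i)) (hK : KernelAssumption p K) (n : ℕ)
    (a b : PolyIdx d p) : Measurable fun ω => sampleMoment p K h r R n ω a b :=
  measurable_localAvg hRm (hK.isLocalWeight_mul_monom_mul_monom a.2.1 b.2.1).measurable n

lemma measurable_sampleBias (hRm : ∀ i, Measurable (R i)) (hK : KernelAssumption p K) (n : ℕ)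
    (a : PolyIdx d p) (b : MonoTuple d (p + 1)) :
    Measurable fun ω => sampleBias p K h r R n ω a b :=
  measurable_localAvg hRm (hK.isLocalWeight_mul_monom_mul_monom a.2.1 b.1).measurable n

lemma measurable_taylorRem (hm : Measurable m) : Measurable (taylorRem p m r) := by
  have hmon : ∀ {L : ℕ} (j : Fin L → Fin d), Measurable fun x => monom j (x - r) :=
    fun j => (continuous_monom j).measurable.comp (measurable_id.sub_const r)
  exact (hm.sub (Finset.measurable_fun_sum _ fun a _ => (hmon a.2.1).const_mul _)).sub
    (Finset.measurable_fun_sum _ fun b _ => (hmon b.1).const_mul _)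

lemma measurable_perturbation (hRm : ∀ i, Measurable (R i)) (hm : Measurable m)
    (hK : KernelAssumption p K) (n : ℕ) (a : PolyIdx d p) :
    Measurable fun ω => perturbation p K m f h r R n ω a := by
  have h1 : ∀ u : MonoTuple d (p + 1) → ℝ, Measurable fun ω =>
      (sampleBias p K h r R n ω - f r • biasMatrix p K).mulVec u a := by
    intro u
    simp only [Matrix.mulVec, dotProduct, Matrix.sub_apply]
    exact Finset.measurable_fun_sum _ fun b _ =>
      ((measurable_sampleBias hRm hK n a b).sub_const _).mul_const _
  have h2 : ∀ u : PolyIdx d p → ℝ, Measurable fun ω =>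
      (sampleMoment p K h r R n ω - f r • momentMatrix p K).mulVec u a := by
    intro u
    simp only [Matrix.mulVec, dotProduct, Matrix.sub_apply]
    exact Finset.measurable_fun_sum _ fun b _ =>
      ((measurable_sampleMoment hRm hK n a b).sub_const _).mul_const _
  have h3 : Measurable fun ω => remainderVec p K m h r R n ω a :=
    measurable_errorSum hRm (fun i => (measurable_taylorRem hm).comp (hRm i))
      (hK.isLocalWeight_mul_monom a.2.1).measurable n
  simp only [perturbation, Pi.add_apply, Pi.sub_apply]
  exact ((h1 _).sub (h2 _)).add h3

/-- The quantities of the normal equations that converge in probability, in one vector: the entries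
of the sample moment matrix and the perturbation. -/
def convergentVec (p : ℕ) (K m f : (Fin d → ℝ) → ℝ) (h : ℕ → Fin d → ℝ) (r : Fin d → ℝ)
    (R : ℕ → Ω → Fin d → ℝ) (n : ℕ) (ω : Ω) :
    (PolyIdx d p × PolyIdx d p) ⊕ PolyIdx d p → ℝ :=
  Sum.elim (fun ab => sampleMoment p K h r R n ω ab.1 ab.2) (perturbation p K m f h r R n ω)

lemma measurable_convergentVec (hRm : ∀ i, Measurable (R i)) (hm : Measurable m)
    (hK : KernelAssumption p K) (n : ℕ) : Measurable (convergentVec p K m f h r R n) := by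
  refine measurable_pi_lambda _ fun i => ?_
  rcases i with ⟨a, b⟩ | a
  · exact measurable_sampleMoment hRm hK n a b
  · exact measurable_perturbation hRm hm hK n a

lemma tendstoInMeasure_convergentVec [IsProbabilityMeasure μ]
    (hRm : ∀ i, Measurable (R i)) (hind : iIndepFun R μ)
    (hid : ∀ i, IdentDistrib (R i) (R 0) μ μ) (hf : DensityAssumption (μ.map (R 0)) f r)
    (hK : KernelAssumption p K) (hb : BandwidthAssumption p h)
    (ha : Tendsto (effSize h) atTop atTop)
    (hs : ∃ U : Set (Fin d → ℝ), IsOpen U ∧ r ∈ U ∧ ContDiffOn ℝ ((p + 1 : ℕ) : ℕ∞) m U) :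
    TendstoInMeasure μ (convergentVec p K m f h r R) atTop
      (fun _ => Sum.elim (fun ab => (f r • momentMatrix p K) ab.1 ab.2) 0) := by
  refine tendstoInMeasure_pi fun i => ?_
  rcases i with ⟨a, b⟩ | a
  · simp only [convergentVec, Sum.elim_inl, sampleMoment, Matrix.of_apply, Matrix.smul_apply,
      momentMatrix, smul_eq_mul]
    exact tendstoInMeasure_localAvg hRm hind hid hf hb.pos hb.tendsto_zero ha
      (hK.isLocalWeight_mul_monom_mul_monom a.2.1 b.2.1)
  · simp only [convergentVec, Sum.elim_inr, Pi.zero_apply]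
    exact tendstoInMeasure_perturbation hRm hind hid hf hK hb ha hs a

/-- The linear term is asymptotically normal. Its inner product with a fixed vector `t` is again a
weighted error sum, with weight `K` times a polynomial, so one-dimensional convergence of
characteristic functions suffices. -/
lemma tendstoInDistribution_linearTerm [IsProbabilityMeasure μ] [IsMarkovKernel κ]
    (hmodel : RegressionModel μ R Y ε m κ)
    (hf : DensityAssumption (μ.map (R 0)) f r) (hK : KernelAssumption p K)
    (hs : SmoothnessAssumption p m κ r) (hb : BandwidthAssumption p h)
    (ha : Tendsto (effSize h) atTop atTop) :
    TendstoInDistribution (fun n ω => WithLp.toLp 2 (linearTerm p K f h r R ε n ω)) atTop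
      (id : EuclideanSpace ℝ (PolyIdx d p) → EuclideanSpace ℝ (PolyIdx d p))
      (fun _ => μ) (multivariateGaussian 0 (asympCov p K f κ r)) := by
  have hmeas : ∀ n, Measurable fun ω => WithLp.toLp 2 (linearTerm p K f h r R ε n ω) := by
    intro n
    have h1 : Measurable (scoreVec p K h r R ε n) := measurable_pi_lambda _ fun a =>
      measurable_errorSum hmodel.measurable_R hmodel.measurable_error
        (hK.isLocalWeight_mul_monom a.2.1).measurable n
    have h2 : Continuous fun v : PolyIdx d p → ℝ =>
        WithLp.toLp 2 (((f r)⁻¹ • (momentMatrix p K)⁻¹).mulVec v) :=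
      (PiLp.continuous_toLp 2 _).comp (continuous_const.matrix_mulVec continuous_id)
    exact h2.measurable.comp h1
  refine ⟨fun n => (hmeas n).aemeasurable, aemeasurable_id, ?_⟩
  refine ProbabilityMeasure.tendsto_of_tendsto_charFun fun t => ?_
  set q : PolyIdx d p → ℝ := Matrix.vecMul (WithLp.ofLp t) ((f r)⁻¹ • (momentMatrix p K)⁻¹)
    with hq
  have hG : IsLocalWeight fun z => K z * ∑ b, q b * monom b.2.1 z :=
    hK.isLocalWeight.mul_continuous
      (continuous_finsetSum _ fun b _ => continuous_const.mul (continuous_monom b.2.1))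
  have hinner : ∀ n ω, inner ℝ (WithLp.toLp 2 (linearTerm p K f h r R ε n ω)) t
      = errorSum (fun z => K z * ∑ b, q b * monom b.2.1 z) h r R ε n ω := by
    intro n ω
    rw [EuclideanSpace.inner_eq_star_dotProduct, star_trivial, linearTerm,
      Matrix.dotProduct_mulVec, ← hq]
    simp only [dotProduct, scoreVec, errorSum]
    simp_rw [Finset.mul_sum]
    rw [Finset.sum_comm]
    refine Finset.sum_congr rfl fun i _ => ?_
    rw [Finset.sum_mul, Finset.mul_sum]
    refine Finset.sum_congr rfl fun b _ => ?_
    ring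
  have hlim := tendsto_charFun_errorSum hmodel hf hs hb.pos hb.tendsto_zero ha hG
  have hcov : f r * condVar κ r * ∫ z, (K z * ∑ b, q b * monom b.2.1 z) ^ 2
      = WithLp.ofLp t ⬝ᵥ (asympCov p K f κ r).mulVec (WithLp.ofLp t) := by
    have hSt : (momentMatrix p K)⁻¹.transpose = (momentMatrix p K)⁻¹ := by
      rw [Matrix.transpose_nonsing_inv, momentMatrix_transpose]
    have hq' : q = (f r)⁻¹ • (momentMatrix p K)⁻¹.mulVec (WithLp.ofLp t) := by
      rw [hq, Matrix.vecMul_smul, ← Matrix.mulVec_transpose, hSt]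
    have hq'' : q = (f r)⁻¹ • Matrix.vecMul (WithLp.ofLp t) (momentMatrix p K)⁻¹ := by
      rw [hq, Matrix.vecMul_smul]
    rw [← dotProduct_sqMomentMatrix_mulVec hK]
    conv_lhs => rw [hq', Matrix.mulVec_smul, dotProduct_smul, ← hq', hq'', smul_dotProduct]
    rw [asympCov, Matrix.smul_mulVec, dotProduct_smul, ← Matrix.mulVec_mulVec,
      ← Matrix.mulVec_mulVec, Matrix.dotProduct_mulVec _ (momentMatrix p K)⁻¹]
    have hf0 := hf.pos.ne'
    simp only [smul_eq_mul]
    field_simp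
  have hG0 : charFun (multivariateGaussian 0 (asympCov p K f κ r)) t
      = Complex.exp (-((f r * condVar κ r
        * ∫ z, (K z * ∑ b, q b * monom b.2.1 z) ^ 2 : ℝ) : ℂ) / 2) := by
    rw [charFun_multivariateGaussian (asympCov_posSemidef hK hf.pos), hcov]
    simp
    ring_nf
  simp only [ProbabilityMeasure.coe_mk, Measure.map_id]
  rw [hG0]
  refine hlim.congr fun n => ?_
  rw [charFun_apply, integral_map (hmeas n).aemeasurable
    (Measurable.aestronglyMeasurable (by fun_prop))]
  simp_rw [hinner]

lemma continuous_scaledError {n : ℕ} : Continuous (scaledError p K m h r n) := by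
  have h1 : Continuous fun β : PolyIdx d p → ℝ =>
      (bandMatrix p (h n)).mulVec (β - derivVec p m r) :=
    continuous_const.matrix_mulVec (continuous_id.sub continuous_const)
  exact (h1.sub continuous_const).const_smul (Real.sqrt (effSize h n))

/-- A continuous extension of `A ↦ A⁻¹ (A₀ w + e)` to all matrices: where `|det A| ≥ c` the factor
in front of the adjugate is `1 / det A`. -/
def cutoffSolve {ι : Type*} [Fintype ι] [DecidableEq ι] (c : ℝ) (A₀ : Matrix ι ι ℝ)
    (x : EuclideanSpace ℝ ι × ((ι × ι) ⊕ ι → ℝ)) : EuclideanSpace ℝ ι :=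
  let A : Matrix ι ι ℝ := Matrix.of fun a b => x.2 (Sum.inl (a, b))
  WithLp.toLp 2 ((A.det / max (A.det ^ 2) (c ^ 2)) •
    A.adjugate.mulVec (A₀.mulVec (WithLp.ofLp x.1) + fun a => x.2 (Sum.inr a)))

lemma continuous_cutoffSolve {ι : Type*} [Fintype ι] [DecidableEq ι] {c : ℝ} (hc : 0 < c)
    (A₀ : Matrix ι ι ℝ) : Continuous (cutoffSolve c A₀) := by
  have hA : Continuous fun x : EuclideanSpace ℝ ι × ((ι × ι) ⊕ ι → ℝ) =>
      (Matrix.of fun a b => x.2 (Sum.inl (a, b)) : Matrix ι ι ℝ) :=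
    continuous_matrix fun a b =>
      (continuous_apply (Sum.inl (a, b) : (ι × ι) ⊕ ι)).comp continuous_snd
  have hdet := hA.matrix_det
  have hx1 : Continuous fun x : EuclideanSpace ℝ ι × ((ι × ι) ⊕ ι → ℝ) => WithLp.ofLp x.1 :=
    (PiLp.continuous_ofLp 2 _).comp continuous_fst
  have hx2 : Continuous fun x : EuclideanSpace ℝ ι × ((ι × ι) ⊕ ι → ℝ) =>
      fun a => x.2 (Sum.inr a) :=
    continuous_pi fun a => (continuous_apply _).comp continuous_snd
  have hfac : Continuous fun x : EuclideanSpace ℝ ι × ((ι × ι) ⊕ ι → ℝ) =>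
      (Matrix.of fun a b => x.2 (Sum.inl (a, b)) : Matrix ι ι ℝ).det
        / max ((Matrix.of fun a b => x.2 (Sum.inl (a, b)) : Matrix ι ι ℝ).det ^ 2) (c ^ 2) :=
    hdet.div ((hdet.pow 2).max continuous_const) fun x =>
      (lt_max_of_lt_right (by positivity)).ne'
  exact (PiLp.continuous_toLp 2 _).comp (hfac.smul
    (hA.matrix_adjugate.matrix_mulVec ((continuous_const.matrix_mulVec hx1).add hx2)))

lemma cutoffSolve_eq {ι : Type*} [Fintype ι] [DecidableEq ι] {c : ℝ} (hc : 0 < c)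
    {A₀ A : Matrix ι ι ℝ} (hA : c ≤ |A.det|) {w : EuclideanSpace ℝ ι} {e T : ι → ℝ}
    (hT : A.mulVec T = A₀.mulVec (WithLp.ofLp w) + e) :
    cutoffSolve c A₀ (w, Sum.elim (fun ab => A ab.1 ab.2) e) = WithLp.toLp 2 T := by
  have hmax : max (A.det ^ 2) (c ^ 2) = A.det ^ 2 := by
    rw [max_eq_left]
    rw [← sq_abs A.det]
    exact pow_le_pow_left₀ hc.le hA 2
  have hdet : A.det ≠ 0 := fun h0 => by
    rw [h0, abs_zero] at hA
    linarith
  have hof : (Matrix.of fun a b => A a b : Matrix ι ι ℝ) = A := rfl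
  simp only [cutoffSolve, Sum.elim_inl, Sum.elim_inr, hof]
  rw [hmax, ← hT, Matrix.mulVec_mulVec, Matrix.adjugate_mul, Matrix.smul_mulVec,
    Matrix.one_mulVec, smul_smul]
  congr 1
  have : A.det / A.det ^ 2 * A.det = 1 := by field_simp
  rw [this, one_smul]

end Limit

end

end LocalPoly

open LocalPoly in
theorem theoremB1 {Ω : Type*} [MeasurableSpace Ω] (μ : Measure Ω) [IsProbabilityMeasure μ]
    (d p : ℕ) (hd : 0 < d)
    (R : ℕ → Ω → Fin d → ℝ) (Y ε : ℕ → Ω → ℝ) (m f K : (Fin d → ℝ) → ℝ)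
    (κ : Kernel (Fin d → ℝ) ℝ) [IsMarkovKernel κ]
    (r : Fin d → ℝ) (h : ℕ → Fin d → ℝ)
    (hmodel : LocalPoly.RegressionModel μ R Y ε m κ)
    (hdensity : LocalPoly.DensityAssumption (μ.map (R 0)) f r)
    (hkernel : LocalPoly.KernelAssumption p K)
    (hsmooth : LocalPoly.SmoothnessAssumption p m κ r)
    (hband : LocalPoly.BandwidthAssumption p h)
    (βhat : ℕ → Ω → LocalPoly.PolyIdx d p → ℝ)
    (hβ_meas : ∀ n, AEMeasurable (βhat n) μ)
    (hβ_min : ∀ n, ∀ᵐ ω ∂μ,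
      IsMinOn (LocalPoly.criterion p K (h n) r n (fun i => R i ω) (fun i => Y i ω))
        Set.univ (βhat n ω)) :
    (LocalPoly.asympCov p K f κ r).PosSemidef ∧
    TendstoInDistribution
      (fun (n : ℕ) (ω : Ω) => WithLp.toLp 2
        (Real.sqrt ((n : ℝ) * ∏ k, h n k) •
          ((LocalPoly.bandMatrix p (h n)).mulVec (βhat n ω - LocalPoly.derivVec p m r)
            - ((LocalPoly.momentMatrix p K)⁻¹ * LocalPoly.biasMatrix p K).mulVec
                (LocalPoly.biasVec p m r (h n)))))
      atTop
      (id : EuclideanSpace ℝ (LocalPoly.PolyIdx d p) →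
        EuclideanSpace ℝ (LocalPoly.PolyIdx d p))
      (fun _ => μ)
      (multivariateGaussian 0 (LocalPoly.asympCov p K f κ r)) := by
  refine ⟨asympCov_posSemidef hkernel hdensity.pos, ?_⟩
  change TendstoInDistribution (fun n ω => WithLp.toLp 2 (scaledError p K m h r n (βhat n ω)))
    atTop id (fun _ => μ) _
  have ha : Tendsto (effSize h) atTop atTop := hband.tendsto_effSize hd
  have hRm := hmodel.measurable_R
  have hind : iIndepFun R μ := hmodel.indep.comp (fun _ q => q.1) fun _ => measurable_fst
  have hid : ∀ i, IdentDistrib (R i) (R 0) μ μ := fun i =>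
    (hmodel.identDistrib i).comp measurable_fst
  set A₀ : Matrix (PolyIdx d p) (PolyIdx d p) ℝ := f r • momentMatrix p K with hA₀
  have hdet₀ : A₀.det ≠ 0 := by
    rw [hA₀, Matrix.det_smul]
    exact mul_ne_zero (pow_ne_zero _ hdensity.pos.ne') hkernel.nonsingular
  set c : ℝ := |A₀.det| / 2 with hc_def
  have hc : 0 < c := half_pos (abs_pos.2 hdet₀)
  set z₀ : (PolyIdx d p × PolyIdx d p) ⊕ PolyIdx d p → ℝ :=
    Sum.elim (fun ab => A₀ ab.1 ab.2) 0 with hz₀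
  set Z := convergentVec p K m f h r R with hZ
  have hZlim : TendstoInMeasure μ Z atTop (fun _ => z₀) :=
    tendstoInMeasure_convergentVec hRm hind hid hdensity hkernel hband ha hsmooth.smooth
  have hZm : ∀ n, Measurable (Z n) := measurable_convergentVec hRm hmodel.measurable_m hkernel
  have hlin := tendstoInDistribution_linearTerm hmodel hdensity hkernel hsmooth hband ha
  have hslutsky := hlin.continuous_comp_prodMk_of_tendstoInMeasure_const
    (continuous_cutoffSolve hc A₀) hZlim fun n => (hZm n).aemeasurable
  have hlimit : (fun w : EuclideanSpace ℝ (PolyIdx d p) => cutoffSolve c A₀ (id w, z₀)) = id := by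
    ext1 w
    exact cutoffSolve_eq hc (half_le_self (abs_nonneg _)) (add_zero _).symm
  rw [hlimit] at hslutsky
  refine tendstoInDistribution_of_tendstoInMeasure_sub _ _ hslutsky ?_ fun n => ?_
  · -- Off an event of vanishing probability, the estimation error is the cutoff solution.
    have hdetc : ∀ᶠ z in 𝓝 z₀, c < |(Matrix.of fun a b => z (Sum.inl (a, b)) :
        Matrix (PolyIdx d p) (PolyIdx d p) ℝ).det| := by
      have hmat : Continuous fun z : (PolyIdx d p × PolyIdx d p) ⊕ PolyIdx d p → ℝ =>
          (Matrix.of fun a b => z (Sum.inl (a, b)) : Matrix (PolyIdx d p) (PolyIdx d p) ℝ) :=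
        continuous_matrix fun a b =>
          continuous_apply (Sum.inl (a, b) : (PolyIdx d p × PolyIdx d p) ⊕ PolyIdx d p)
      have hcont : Continuous fun z : (PolyIdx d p × PolyIdx d p) ⊕ PolyIdx d p → ℝ =>
          |(Matrix.of fun a b => z (Sum.inl (a, b)) :
            Matrix (PolyIdx d p) (PolyIdx d p) ℝ).det| :=
        hmat.matrix_det.abs
      exact hcont.continuousAt.eventually_const_lt (half_lt_self (abs_pos.2 hdet₀))
    obtain ⟨ρ, hρ, hball⟩ := Metric.eventually_nhds_iff.1 hdetc
    rw [tendstoInMeasure_iff_norm]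
    rw [tendstoInMeasure_iff_norm] at hZlim
    intro e he
    refine tendsto_of_tendsto_of_tendsto_of_le_of_le' tendsto_const_nhds (hZlim ρ hρ)
      (Eventually.of_forall fun _ => zero_le) ?_
    filter_upwards [eventually_ge_atTop 1] with n hn
    refine measure_mono_ae ?_
    filter_upwards [hβ_min n] with ω hω
    intro he'
    by_contra hcon
    have hclose : dist (Z n ω) z₀ < ρ := by
      rw [dist_eq_norm]
      exact not_le.1 hcon
    have hdetω : c ≤ |(sampleMoment p K h r R n ω).det| := (hball hclose).le
    have hsolve : cutoffSolve c A₀ (WithLp.toLp 2 (linearTerm p K f h r R ε n ω), Z n ω)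
        = WithLp.toLp 2 (scaledError p K m h r n (βhat n ω)) := by
      refine cutoffSolve_eq hc hdetω ?_
      rw [sampleMoment_mulVec_scaledError (f := f) hband.pos hkernel.nonsingular hn
        (fun i => hmodel.model i ω) hω]
      congr 1
      rw [linearTerm, Matrix.mulVec_mulVec, hA₀, Matrix.smul_mul, Matrix.mul_smul, smul_smul,
        mul_inv_cancel₀ hdensity.pos.ne', one_smul,
        Matrix.mul_nonsing_inv _ (isUnit_iff_ne_zero.2 hkernel.nonsingular), Matrix.one_mulVec]
    have hzero : WithLp.toLp 2 (scaledError p K m h r n (βhat n ω))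
        - cutoffSolve c A₀ (WithLp.toLp 2 (linearTerm p K f h r R ε n ω), Z n ω) = 0 := by
      rw [hsolve, sub_self]
    have he'' : e ≤ ‖WithLp.toLp 2 (scaledError p K m h r n (βhat n ω))
        - cutoffSolve c A₀ (WithLp.toLp 2 (linearTerm p K f h r R ε n ω), Z n ω) - 0‖ := he'
    rw [hzero, sub_zero, norm_zero] at he''
    linarith
  · exact ((PiLp.continuous_toLp 2 _).comp continuous_scaledError).measurable.comp_aemeasurable
      (hβ_meas n)
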